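/- Let $K$ be Hilbert's number system: its elements are the formal series $a=\sum_{i\ge N}P_i(s)\,t^i$ with $N\in\mathbb Z$ and $P_i(s)=\sum_{k\ge N_i}\alpha_{k,i}s^k$ a real Laurent series in $s$ ($N_i\in\mathbb Z$ depending on $i$ and on $a$), with coefficientwise addition and with the multiplication determined by $ts=2st$, that is, $\left(\sum_i P_i(s)t^i\right)\left(\sum_j Q_j(s)t^j\right)=\sum_n\left(\sum_{i+j=n}P_i(s)\,Q_j(2^is)\right)t^n$. Call $a\neq 0$ positive if $\alpha_{M,m}>0$, where $m$ is the smallest power of $t$ that occurs in $a$ and $M$ the smallest power of $s$ that occurs in $P_m$, and let $a<b$ mean that $b-a$ is positive. Then: (1) With these operations and this order $K$ is a linearly ordered skew field (division ring). It is proper: $ts=2st\neq st$. It is non-Archimedean; in fact $0<t$, $mt<s$ and $ns<1$ for all natural numbers $m,n$. (2) Consider the coordinate plane over $K$. Points are pairs $(x,y)\in K^2$; lines are given by equations $ax+by+c=0$ with $(a,b)\neq(0,0)$, where two equations that differ by a left factor define the same line. Two distinct lines are parallel if their coefficient pairs $(a_1,b_1)$, $(a_2,b_2)$ are left-proportional.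 For three collinear points, $P_2$ is between $P_1$ and $P_3$ if $x_1<x_2<x_3$ or $x_1>x_2>x_3$, or, on a line parallel to the $y$-axis, if $y_1<y_2<y_3$ or $y_1>y_2>y_3$. This plane satisfies Hilbert's plane incidence axioms, Hilbert's plane order axioms (including Pasch's axiom) and the parallel postulate (through a point outside a line $g$ there is exactly one line not meeting $g$). Two distinct lines are parallel if and only if they have no common point. (3) Adjoin to this plane one improper point for each class of parallel lines, lying on the lines of that class, and a line at infinity consisting of all improper points. The extended plane satisfies the projective incidence axioms (any two distinct points are on exactly one line, any two distinct lines meet in exactly one point, and there are four points no three of which are collinear). Desargues' theorem holds in both directions: for two (nondegenerate) triangles with distinct corresponding vertices and distinct corresponding sides, the lines connecting corresponding vertices go through a point if and only if the intersections of corresponding sides lie on a line. (4) Pappus' theorem is false in the extended plane: it is not true that for every hexagon $p_1\dots p_6$ with distinct vertices lying alternately on two distinct lines, none on both, the points $p_1p_2\cap p_4p_5$, $p_2p_3\cap p_5p_6$, $p_3p_4\cap p_6p_1$ are collinear. Explicitly, let $p_1=(st,0)$, $p_3=(t,0)$, $p_5=(s,0)$ on the $x$-axis and $p_2=(0,t)$,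 $p_4=(0,1)$, $p_6=(0,s)$ on the $y$-axis, and let $$g:\ sy+x-s=0,\quad g':\ sy+x-st=0,\quad k:\ ty+x-t=0,\quad k':\ ty+x-ts=0,\quad l:\ x+y-s=0,\quad l':\ x+y-t=0 .$$ Then $p_1p_2=g'$ is parallel to $p_4p_5=g$, and $p_2p_3=l'$ is parallel to $p_5p_6=l$, but $p_6p_1$ is neither equal nor parallel to $p_3p_4=k$: the parallel to $k$ through $p_6$ is $k'$, which meets the $x$-axis at $(ts,0)\neq(st,0)$. In particular, Pappus' theorem does not follow from the plane incidence and order axioms, the parallel postulate and Desargues' theorem. -/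

import Mathlib

/-! ## The Hilbert number system

A number is a series `∑_{i ≥ N} P_i(s) t^i`, where each coefficient
`P_i(s) = ∑_{k ≥ N_i} α_{k,i} s^k` is a Laurent series in `s` over `ℝ`
(no uniformity of the `N_i` in `i` is required). -/

/-- The Hilbert numbers: Laurent series in `t` whose coefficients are Laurent series in `s`.
The real coefficient `α_{k,i}` of `s^k t^i` in `a` is `(a.series.coeff i).coeff k`. -/
@[ext]
structure HilbertNumber : Type where
  /-- The underlying Laurent series in `t`. -/
  series : LaurentSeries (LaurentSeries ℝ)

namespace HilbertNumber

/-- The series `P(2^i s) = ∑ 2^(i k) α_k s^k`, that is, the series `Q` with `t^i P = Q t^i`. -/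
noncomputable def twist (i : ℤ) (P : LaurentSeries ℝ) : LaurentSeries ℝ where
  coeff k := (2 : ℝ) ^ (i * k) * P.coeff k
  isPWO_support' := P.isPWO_support.mono fun k hk => by
    simp only [Function.mem_support, HahnSeries.mem_support] at hk ⊢
    exact right_ne_zero_of_mul hk

/-- Coefficientwise addition. -/
noncomputable def add (a b : HilbertNumber) : HilbertNumber := ⟨a.series + b.series⟩

/-- Coefficientwise subtraction. -/
noncomputable def sub (a b : HilbertNumber) : HilbertNumber := ⟨a.series - b.series⟩

/-- Multiplication determined by `ts = 2st`: the coefficient of `t^n` in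
`(∑ P_i t^i) (∑ Q_j t^j)` is the finite sum of the `P_i(s) Q_j(2^i s)` with `i + j = n`. -/
noncomputable def mul (a b : HilbertNumber) : HilbertNumber where
  series :=
    { coeff := fun n =>
        ∑ ij ∈ Finset.antidiagonal a.series.isPWO_support b.series.isPWO_support n,
          a.series.coeff ij.1 * twist ij.1 (b.series.coeff ij.2)
      isPWO_support' := by
        refine (a.series.isPWO_support.add b.series.isPWO_support).mono fun n hn => ?_
        obtain ⟨ij, hij, -⟩ := Finset.exists_ne_zero_of_sum_ne_zero hn
        rw [Finset.mem_antidiagonal] at hij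
        exact ⟨ij.1, hij.1, ij.2, hij.2.1, hij.2.2⟩ }

/-- The real number `r`, as the constant series `r s^0 t^0`. -/
noncomputable def ofReal (r : ℝ) : HilbertNumber :=
  ⟨HahnSeries.single 0 (HahnSeries.single 0 r)⟩

/-- The parameter `s = 1 s^1 t^0`. -/
noncomputable def s : HilbertNumber := ⟨HahnSeries.single 0 (HahnSeries.single 1 1)⟩

/-- The parameter `t = 1 s^0 t^1`. -/
noncomputable def t : HilbertNumber := ⟨HahnSeries.single 1 (HahnSeries.single 0 1)⟩

/-- `a` is positive when its leading real coefficient is: take the smallest power of `t` that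
occurs in `a`, and in its coefficient `P_i(s)` the smallest power of `s` that occurs.
(Leading coefficients of zero series are `0`, so `0` is not positive.) -/
def Pos (a : HilbertNumber) : Prop := 0 < a.series.leadingCoeff.leadingCoeff

end HilbertNumber

/-! ## Axioms and theorems of plane geometry

Here `Pt` and `Ln` are the types of points and lines, `I P g` says that `P` lies on `g`, and
`B P Q R` says that `Q` lies between `P` and `R`. -/

namespace PlaneGeometry

variable {Pt Ln : Type*}

/-- All the given points lie on a common line. -/
def Collinear (I : Pt → Ln → Prop) (A B C : Pt) : Prop := ∃ g, I A g ∧ I B g ∧ I C g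

/-- The plane incidence axioms. -/
structure IncidenceAxioms (I : Pt → Ln → Prop) : Prop where
  exists_line : ∀ A B, A ≠ B → ∃ g, I A g ∧ I B g
  line_unique : ∀ A B g h, A ≠ B → I A g → I B g → I A h → I B h → g = h
  two_points : ∀ g, ∃ A B, A ≠ B ∧ I A g ∧ I B g
  three_points : ∃ A B C, A ≠ B ∧ A ≠ C ∧ B ≠ C ∧ ¬ Collinear I A B C

/-- The plane order axioms. -/
structure OrderAxioms (I : Pt → Ln → Prop) (B : Pt → Pt → Pt → Prop) : Prop where
  between_distinct : ∀ P Q R, B P Q R → P ≠ Q ∧ P ≠ R ∧ Q ≠ R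
  between_collinear : ∀ P Q R, B P Q R → Collinear I P Q R
  between_symm : ∀ P Q R, B P Q R → B R Q P
  extend : ∀ P Q, P ≠ Q → ∃ R, B P Q R
  exists_between : ∀ P Q R, P ≠ Q → P ≠ R → Q ≠ R → Collinear I P Q R →
    B P Q R ∨ B Q R P ∨ B R P Q
  between_unique : ∀ P Q R, B P Q R → ¬ B Q R P
  pasch : ∀ P Q R g, ¬ Collinear I P Q R → ¬ I P g → ¬ I Q g → ¬ I R g →
    (∃ X, I X g ∧ B P X Q) → (∃ X, I X g ∧ B P X R) ∨ (∃ X, I X g ∧ B Q X R)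

/-- The parallel postulate: through a point `P` outside `g` there is exactly one line that does
not meet `g`. -/
def ParallelPostulate (I : Pt → Ln → Prop) : Prop :=
  ∀ P g, ¬ I P g → ∃! h, I P h ∧ ∀ Q, ¬ (I Q g ∧ I Q h)

/-- The projective incidence theorems: two points have exactly one connecting line, two lines have
exactly one intersection point, and there is a quadrangle. -/
structure ProjectiveIncidence (I : Pt → Ln → Prop) : Prop where
  line : ∀ A B, A ≠ B → ∃! g, I A g ∧ I B g
  point : ∀ g h, g ≠ h → ∃! A, I A g ∧ I A h
  quadrangle : ∃ A B C D, ¬ Collinear I A B C ∧ ¬ Collinear I A B D ∧ ¬ Collinear I A C D ∧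
    ¬ Collinear I B C D

/-- Desargues' theorem in a projective plane, in both directions. `A` and `A'` are the vertices of
two triangles, `a i` and `a' i` are the sides opposite to `A i` and `A' i`, corresponding vertices
and corresponding sides are distinct, `c i` connects `A i` and `A' i`, and `X i` is the
intersection of `a i` and `a' i`. Then the `c i` go through a point if and only if the `X i` lie
on a line. -/
def Desargues (I : Pt → Ln → Prop) : Prop :=
  ∀ (A A' : Fin 3 → Pt) (a a' : Fin 3 → Ln) (c : Fin 3 → Ln) (X : Fin 3 → Pt),
    ¬ Collinear I (A 0) (A 1) (A 2) → ¬ Collinear I (A' 0) (A' 1) (A' 2) →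
    (∀ i j, i ≠ j → I (A j) (a i)) → (∀ i j, i ≠ j → I (A' j) (a' i)) →
    (∀ i, A i ≠ A' i) → (∀ i, a i ≠ a' i) →
    (∀ i, I (A i) (c i) ∧ I (A' i) (c i)) →
    (∀ i, I (X i) (a i) ∧ I (X i) (a' i)) →
    ((∃ O, ∀ i, I O (c i)) ↔ (∃ l, ∀ i, I (X i) l))

/-- The points `p₁, …, p₆` are the vertices of a hexagon that lie alternately on the two distinct
lines `g` and `h`; they are distinct, and none of them lies on both lines. -/
structure PappusHexagon (I : Pt → Ln → Prop) (g h : Ln) (p₁ p₂ p₃ p₄ p₅ p₆ : Pt) : Prop where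
  lines_ne : g ≠ h
  on_g : I p₁ g ∧ I p₃ g ∧ I p₅ g
  on_h : I p₂ h ∧ I p₄ h ∧ I p₆ h
  not_on_h : ¬ I p₁ h ∧ ¬ I p₃ h ∧ ¬ I p₅ h
  not_on_g : ¬ I p₂ g ∧ ¬ I p₄ g ∧ ¬ I p₆ g
  ne_on_g : p₁ ≠ p₃ ∧ p₁ ≠ p₅ ∧ p₃ ≠ p₅
  ne_on_h : p₂ ≠ p₄ ∧ p₂ ≠ p₆ ∧ p₄ ≠ p₆

/-- Pappus' theorem in a projective plane: if the vertices of a hexagon lie alternately on `g` and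
`h`, then the intersections `P, Q, R` of opposite sides lie on a line. -/
def Pappus (I : Pt → Ln → Prop) : Prop :=
  ∀ (g h : Ln) (p₁ p₂ p₃ p₄ p₅ p₆ : Pt), PappusHexagon I g h p₁ p₂ p₃ p₄ p₅ p₆ →
    ∀ (l₁₂ l₂₃ l₃₄ l₄₅ l₅₆ l₆₁ : Ln),
      I p₁ l₁₂ ∧ I p₂ l₁₂ → I p₂ l₂₃ ∧ I p₃ l₂₃ → I p₃ l₃₄ ∧ I p₄ l₃₄ →
      I p₄ l₄₅ ∧ I p₅ l₄₅ → I p₅ l₅₆ ∧ I p₆ l₅₆ → I p₆ l₆₁ ∧ I p₁ l₆₁ →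
      ∀ P Q R : Pt, I P l₁₂ ∧ I P l₄₅ → I Q l₂₃ ∧ I Q l₅₆ → I R l₃₄ ∧ I R l₆₁ →
        Collinear I P Q R

end PlaneGeometry

/-! ## The coordinate plane over an ordered skew field -/

namespace CoordPlane

/-- An equation `a x + b y + c = 0` of a line; `a` and `b` are not both `0`. -/
@[ext]
structure LineEq (K : Type*) [DivisionRing K] where
  a : K
  b : K
  c : K
  ne : a ≠ 0 ∨ b ≠ 0

variable {K : Type*} [DivisionRing K]

/-- If the coefficients `a`, `b` of one equation are a left multiple of those of another, then the
factor is not `0`. -/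
theorem LineEq.factor_ne_zero {u v : LineEq K} {l : K} (ha : u.a = l * v.a)
    (hb : u.b = l * v.b) : l ≠ 0 := by
  rintro rfl
  rcases u.ne with h | h
  · exact h (by simpa using ha)
  · exact h (by simpa using hb)

/-- Two equations define the same line when they are proportional (with a factor on the left). -/
def LineEq.sameLine (K : Type*) [DivisionRing K] : Setoid (LineEq K) where
  r u v := ∃ l : K, u.a = l * v.a ∧ u.b = l * v.b ∧ u.c = l * v.c
  iseqv :=
    { refl := fun _ => ⟨1, by simp⟩
      symm := by
        rintro u v ⟨l, ha, hb, hc⟩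
        have hl := LineEq.factor_ne_zero ha hb
        exact ⟨l⁻¹, by simp [ha, hl], by simp [hb, hl], by simp [hc, hl]⟩
      trans := by
        rintro u v w ⟨l, ha, hb, hc⟩ ⟨m, ha', hb', hc'⟩
        exact ⟨l * m, by rw [ha, ha', mul_assoc], by rw [hb, hb', mul_assoc],
          by rw [hc, hc', mul_assoc]⟩ }

/-- Two equations define lines of the same parallel class when the coefficients `a`, `b` are
proportional (with a factor on the left). -/
def LineEq.sameDirection (K : Type*) [DivisionRing K] : Setoid (LineEq K) where
  r u v := ∃ l : K, u.a = l * v.a ∧ u.b = l * v.b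
  iseqv :=
    { refl := fun _ => ⟨1, by simp⟩
      symm := by
        rintro u v ⟨l, ha, hb⟩
        have hl := LineEq.factor_ne_zero ha hb
        exact ⟨l⁻¹, by simp [ha, hl], by simp [hb, hl]⟩
      trans := by
        rintro u v w ⟨l, ha, hb⟩ ⟨m, ha', hb'⟩
        exact ⟨l * m, by rw [ha, ha', mul_assoc], by rw [hb, hb', mul_assoc]⟩ }

/-- The lines of the coordinate plane over `K`. The points are the pairs `(x, y) : K × K`. -/
def Line (K : Type*) [DivisionRing K] : Type _ := Quotient (LineEq.sameLine K)

/-- The improper points, one for each class of parallel lines. -/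
def ImproperPoint (K : Type*) [DivisionRing K] : Type _ := Quotient (LineEq.sameDirection K)

/-- The line `a x + b y + c = 0`. -/
def Line.mk (a b c : K) (ne : a ≠ 0 ∨ b ≠ 0) : Line K :=
  Quotient.mk (LineEq.sameLine K) ⟨a, b, c, ne⟩

/-- The point `P = (x, y)` lies on the line `a x + b y + c = 0`. -/
def Lies (P : K × K) (g : Line K) : Prop :=
  Quotient.lift (s := LineEq.sameLine K) (fun u => u.a * P.1 + u.b * P.2 + u.c = 0) (by
    rintro u v ⟨l, ha, hb, hc⟩
    have hl := LineEq.factor_ne_zero ha hb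
    have key : u.a * P.1 + u.b * P.2 + u.c = l * (v.a * P.1 + v.b * P.2 + v.c) := by
      rw [ha, hb, hc, mul_add, mul_add, mul_assoc, mul_assoc]
    simp [key, hl]) g

/-- The improper point of a line. -/
def Line.improper (g : Line K) : ImproperPoint K :=
  Quotient.lift (s := LineEq.sameLine K) (fun u => Quotient.mk (LineEq.sameDirection K) u) (by
    rintro u v ⟨l, ha, hb, -⟩
    exact Quotient.sound (s := LineEq.sameDirection K) ⟨l, ha, hb⟩) g

/-- Two lines are parallel when their equations satisfy `a₁ = l a₂`, `b₁ = l b₂`, `c₁ ≠ l c₂` for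
some `l`: the coefficients `a`, `b` are proportional, but the equations are not. -/
def Parallel (g h : Line K) : Prop := g ≠ h ∧ g.improper = h.improper

/-- `y` is strictly between `x` and `z`. -/
def NumBetween [LinearOrder K] (x y z : K) : Prop := (x < y ∧ y < z) ∨ (x > y ∧ y > z)

/-- `P₂` lies between the points `P₁` and `P₃` of a line: the abscissas are ordered accordingly, or
the line is parallel to the `y`-axis and the ordinates are ordered accordingly. -/
def Between [LinearOrder K] (P₁ P₂ P₃ : K × K) : Prop :=
  PlaneGeometry.Collinear Lies P₁ P₂ P₃ ∧
    (NumBetween P₁.1 P₂.1 P₃.1 ∨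
      (P₁.1 = P₂.1 ∧ P₂.1 = P₃.1 ∧ NumBetween P₁.2 P₂.2 P₃.2))

/-- The points of the coordinate plane and the improper points. -/
inductive ExtPoint (K : Type*) [DivisionRing K]
  | proper (P : K × K)
  | improper (d : ImproperPoint K)

/-- The lines of the coordinate plane and the line at infinity. -/
inductive ExtLine (K : Type*) [DivisionRing K]
  | proper (g : Line K)
  | infinity

/-- Incidence in the coordinate plane extended by improper points: an improper point lies on the
lines of its parallel class and on the line at infinity. -/
def ExtLies : ExtPoint K → ExtLine K → Prop
  | .proper P, .proper g => Lies P g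
  | .proper _, .infinity => False
  | .improper d, .proper g => g.improper = d
  | .improper _, .infinity => True

end CoordPlane

/-!
Letting the monomial `r tⁱ` act on the Laurent series in `s` as the operator `f(s) ↦ r f(2ⁱ s)`
turns Hilbert's numbers into Laurent series in a central variable over a ring of operators. Their
ring axioms, leading coefficients and inverses are thus those of ordinary Laurent series. The order
is the lexicographic one on iterated series, and the leading coefficient of a product is the product
of the leading coefficients up to a positive power of `2`.

The extended plane has homogeneous coordinates, columns up to right factors for points and rows up
to left factors for lines. Its incidence axioms are linear algebra, and in Desargues' theorem the
axis appears as a relation between the vertices scaled to represent the center; the converse is the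
same statement for the dual coordinates over the opposite skew field. A point is between two others
of its line exactly if it is between them lexicographically. Pasch's axiom holds because
`a x + b y + c` is monotone along each line and so changes sign between two points exactly if the
line `a x + b y + c = 0` meets the segment.

Two pairs of opposite sides of the hexagon are parallel whatever `s` and `t` are, but the third pair
is parallel only if `s t = t s`.
-/

theorem hahnSeries_order_eq_of_support_eq {Γ R S : Type*} [PartialOrder Γ] [Zero Γ]
    [Zero R] [Zero S] {x : HahnSeries Γ R} {y : HahnSeries Γ S} (h : x.support = y.support) :
    x.order = y.order := by
  have hxy : x = 0 ↔ y = 0 := by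
    rw [← HahnSeries.support_eq_empty_iff, h, HahnSeries.support_eq_empty_iff]
  by_cases hx : x = 0
  · rw [hx, hxy.1 hx, HahnSeries.order_zero, HahnSeries.order_zero]
  · rw [HahnSeries.order_of_ne hx, HahnSeries.order_of_ne (mt hxy.2 hx)]
    simp_rw [h]

theorem laurentSeries_exists_mul_eq_one {A : Type*} [Ring A] {x : LaurentSeries A}
    (hx : IsUnit x.leadingCoeff) : ∃ y, x * y = 1 := by
  obtain ⟨u, hu⟩ := hx
  have hconst : PowerSeries.constantCoeff x.powerSeriesPart = u := by
    rw [← PowerSeries.coeff_zero_eq_constantCoeff_apply, LaurentSeries.powerSeriesPart_coeff,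
      Nat.cast_zero, add_zero, ← HahnSeries.leadingCoeff_eq, hu]
  refine ⟨HahnSeries.ofPowerSeries ℤ A (x.powerSeriesPart.invOfUnit u) *
    HahnSeries.single (-x.order) 1, ?_⟩
  calc x * (HahnSeries.ofPowerSeries ℤ A (x.powerSeriesPart.invOfUnit u) *
        HahnSeries.single (-x.order) 1)
      = HahnSeries.single x.order 1 *
          HahnSeries.ofPowerSeries ℤ A (x.powerSeriesPart * x.powerSeriesPart.invOfUnit u) *
            HahnSeries.single (-x.order) 1 := by
        nth_rw 1 [← x.single_order_mul_powerSeriesPart]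
        rw [map_mul, mul_assoc, mul_assoc, mul_assoc]
    _ = 1 := by
        rw [PowerSeries.mul_invOfUnit _ _ hconst, RingHom.map_one, mul_one,
          HahnSeries.single_mul_single, add_neg_cancel, mul_one, HahnSeries.single_zero_one]

/-- The ring of skew Hahn series: the formal series `∑ rᵢ tⁱ` in a variable `t` with
`tⁱ r = φ i r tⁱ`. A series is stored as the Hahn series of its left coefficients `rᵢ`. -/
@[ext]
structure SkewHahnSeries {Γ R : Type*} [AddMonoid Γ] [PartialOrder Γ] [Semiring R]
    (φ : Multiplicative Γ →* R →+* R) where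
  /-- The Hahn series with the same coefficients. -/
  toHahnSeries : HahnSeries Γ R

namespace SkewHahnSeries

open Multiplicative (ofAdd)

section MonomialEnd

variable {Γ R : Type*} [AddMonoid Γ] [Semiring R] {φ : Multiplicative Γ →* R →+* R}

/-- The operator `f ↦ r * φ i f` on `R`, by which the monomial `r tⁱ` is represented. -/
def monomialEnd (φ : Multiplicative Γ →* R →+* R) (i : Γ) : R →+ AddMonoid.End R :=
  (AddMonoidHom.mulRight (DistribMulAction.toAddMonoidEnd (R →+* R) R (φ (ofAdd i)))).comp
    (Module.toAddMonoidEnd R R : R →+ AddMonoid.End R)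

theorem monomialEnd_apply (i : Γ) (r f : R) : monomialEnd φ i r f = r * φ (ofAdd i) f := rfl

theorem monomialEnd_injective (i : Γ) : Function.Injective (monomialEnd φ i) := fun r q h => by
  simpa [monomialEnd_apply] using DFunLike.congr_fun h 1

theorem monomialEnd_mul_monomialEnd (i j : Γ) (r q : R) :
    monomialEnd φ i r * monomialEnd φ j q = monomialEnd φ (i + j) (r * φ (ofAdd i) q) := by
  ext f
  change r * φ (ofAdd i) (q * φ (ofAdd j) f) = r * φ (ofAdd i) q * φ (ofAdd (i + j)) f
  rw [map_mul, ofAdd_add, map_mul, RingHom.coe_mul, Function.comp_apply, mul_assoc]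

theorem monomialEnd_zero_one : monomialEnd φ 0 1 = 1 := by
  ext f
  simp [monomialEnd_apply]

end MonomialEnd

section Ring

variable {Γ R : Type*} [AddCommMonoid Γ] [PartialOrder Γ] [Ring R]
  {φ : Multiplicative Γ →* R →+* R}

/-- A skew Hahn series is determined by its Hahn series of coefficients. -/
def equivHahnSeries (φ : Multiplicative Γ →* R →+* R) : SkewHahnSeries φ ≃ HahnSeries Γ R :=
  ⟨toHahnSeries, mk, fun _ => rfl, fun _ => rfl⟩

instance : AddCommGroup (SkewHahnSeries φ) := (equivHahnSeries φ).addCommGroup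

noncomputable instance : One (SkewHahnSeries φ) := ⟨⟨1⟩⟩

theorem toHahnSeries_one : (1 : SkewHahnSeries φ).toHahnSeries = 1 := rfl

/-- The representation of a skew Hahn series by a Hahn series of operators, in which the variable
is central. -/
def toEnd (x : SkewHahnSeries φ) : HahnSeries Γ (AddMonoid.End R) where
  coeff i := monomialEnd φ i (x.toHahnSeries.coeff i)
  isPWO_support' := x.toHahnSeries.isPWO_support.mono fun i hi => by
    simpa [map_eq_zero_iff _ (monomialEnd_injective i)] using hi

theorem coeff_toEnd (x : SkewHahnSeries φ) (i : Γ) :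
    x.toEnd.coeff i = monomialEnd φ i (x.toHahnSeries.coeff i) := rfl

theorem support_toEnd (x : SkewHahnSeries φ) : x.toEnd.support = x.toHahnSeries.support := by
  ext i
  simp [coeff_toEnd, map_eq_zero_iff _ (monomialEnd_injective i)]

theorem toEnd_injective : Function.Injective (toEnd (φ := φ)) := fun x y h => by
  ext i
  exact monomialEnd_injective i (congrArg (fun z => HahnSeries.coeff z i) h)

theorem toEnd_zero : (0 : SkewHahnSeries φ).toEnd = 0 := by
  ext1
  exact funext fun i => map_zero (monomialEnd φ i)

theorem toEnd_add (x y : SkewHahnSeries φ) : (x + y).toEnd = x.toEnd + y.toEnd := by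
  ext1
  exact funext fun i => map_add (monomialEnd φ i) _ _

theorem toEnd_one : (1 : SkewHahnSeries φ).toEnd = 1 := by
  ext1
  funext i
  rw [coeff_toEnd, toHahnSeries_one, HahnSeries.coeff_one, HahnSeries.coeff_one]
  split_ifs with h
  · rw [h, monomialEnd_zero_one]
  · exact map_zero (monomialEnd φ i)

theorem toEnd_mk_single (i : Γ) (r : R) :
    toEnd (mk (HahnSeries.single i r) : SkewHahnSeries φ) =
      HahnSeries.single i (monomialEnd φ i r) := by
  ext1
  funext j
  rw [coeff_toEnd, HahnSeries.coeff_single, HahnSeries.coeff_single]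
  split_ifs with h
  · rw [h]
  · exact map_zero (monomialEnd φ j)

/-- The skew Hahn series with coefficients `f 1`, for the coefficients `f` of a Hahn series of
operators on `R`. -/
def evalOne (φ : Multiplicative Γ →* R →+* R) (y : HahnSeries Γ (AddMonoid.End R)) :
    SkewHahnSeries φ := ⟨y.map (AddMonoidHom.eval (1 : R))⟩

theorem coeff_evalOne (y : HahnSeries Γ (AddMonoid.End R)) (i : Γ) :
    (evalOne φ y).toHahnSeries.coeff i = y.coeff i 1 := rfl

theorem evalOne_one : evalOne φ 1 = 1 := by
  ext i
  rw [coeff_evalOne, toHahnSeries_one, HahnSeries.coeff_one, HahnSeries.coeff_one]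
  split_ifs <;> rfl

variable [IsOrderedCancelAddMonoid Γ]

noncomputable instance : Mul (SkewHahnSeries φ) where
  mul x y := ⟨{
    coeff := fun n =>
      ∑ ij ∈ Finset.antidiagonal x.toHahnSeries.isPWO_support y.toHahnSeries.isPWO_support n,
        x.toHahnSeries.coeff ij.1 * φ (ofAdd ij.1) (y.toHahnSeries.coeff ij.2)
    isPWO_support' := by
      refine (x.toHahnSeries.isPWO_support.add y.toHahnSeries.isPWO_support).mono fun n hn => ?_
      obtain ⟨ij, hij, -⟩ := Finset.exists_ne_zero_of_sum_ne_zero hn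
      rw [Finset.mem_antidiagonal] at hij
      exact ⟨ij.1, hij.1, ij.2, hij.2.1, hij.2.2⟩ }⟩

theorem coeff_mul (x y : SkewHahnSeries φ) (n : Γ) : (x * y).toHahnSeries.coeff n =
    ∑ ij ∈ Finset.antidiagonal x.toHahnSeries.isPWO_support y.toHahnSeries.isPWO_support n,
      x.toHahnSeries.coeff ij.1 * φ (ofAdd ij.1) (y.toHahnSeries.coeff ij.2) := rfl

theorem toEnd_mul (x y : SkewHahnSeries φ) : (x * y).toEnd = x.toEnd * y.toEnd := by
  ext1
  funext n
  rw [coeff_toEnd, coeff_mul, HahnSeries.coeff_mul, map_sum]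
  simp_rw [support_toEnd]
  refine Finset.sum_congr rfl fun ij hij => ?_
  rw [coeff_toEnd, coeff_toEnd, monomialEnd_mul_monomialEnd, (Finset.mem_antidiagonal.1 hij).2.2]

theorem mk_single_mul_mk_single (i j : Γ) (r q : R) :
    (mk (HahnSeries.single i r) * mk (HahnSeries.single j q) : SkewHahnSeries φ) =
      mk (HahnSeries.single (i + j) (r * φ (ofAdd i) q)) :=
  toEnd_injective (by
    rw [toEnd_mul, toEnd_mk_single, toEnd_mk_single, toEnd_mk_single,
      HahnSeries.single_mul_single, monomialEnd_mul_monomialEnd])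

noncomputable instance : Ring (SkewHahnSeries φ) where
  __ := (inferInstance : AddCommGroup (SkewHahnSeries φ))
  zero_mul x := toEnd_injective (by rw [toEnd_mul, toEnd_zero, zero_mul])
  mul_zero x := toEnd_injective (by rw [toEnd_mul, toEnd_zero, mul_zero])
  one_mul x := toEnd_injective (by rw [toEnd_mul, toEnd_one, one_mul])
  mul_one x := toEnd_injective (by rw [toEnd_mul, toEnd_one, mul_one])
  mul_assoc x y z := toEnd_injective (by simp only [toEnd_mul, mul_assoc])
  left_distrib x y z := toEnd_injective (by simp only [toEnd_mul, toEnd_add, mul_add])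
  right_distrib x y z := toEnd_injective (by simp only [toEnd_mul, toEnd_add, add_mul])

theorem mul_evalOne (x : SkewHahnSeries φ) (y : HahnSeries Γ (AddMonoid.End R)) :
    x * evalOne φ y = evalOne φ (x.toEnd * y) := by
  ext n
  have hsupp : (evalOne φ y).toHahnSeries.support ⊆ y.support := fun j hj h => hj (by
    rw [coeff_evalOne, h]
    rfl)
  rw [coeff_evalOne, HahnSeries.coeff_mul, coeff_mul]
  simp_rw [support_toEnd]
  refine Eq.trans ?_ (map_sum (AddMonoidHom.eval (1 : R)) _ _).symm
  refine Finset.sum_subset (Finset.antidiagonal_mono_right hsupp) fun ij hij hij' => ?_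
  rw [Finset.mem_antidiagonal] at hij hij'
  have hj : (evalOne φ y).toHahnSeries.coeff ij.2 = 0 := by
    by_contra h
    exact hij' ⟨hij.1, h, hij.2.2⟩
  rw [hj, map_zero, mul_zero]

end Ring

section LeadingCoeff

variable {Γ R : Type*} [AddCommMonoid Γ] [LinearOrder Γ] [Ring R]
  {φ : Multiplicative Γ →* R →+* R}

theorem order_toEnd (x : SkewHahnSeries φ) : x.toEnd.order = x.toHahnSeries.order :=
  hahnSeries_order_eq_of_support_eq x.support_toEnd

theorem leadingCoeff_toEnd (x : SkewHahnSeries φ) :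
    x.toEnd.leadingCoeff = monomialEnd φ x.toHahnSeries.order x.toHahnSeries.leadingCoeff := by
  rw [HahnSeries.leadingCoeff_eq, order_toEnd, coeff_toEnd, HahnSeries.leadingCoeff_eq]

theorem leadingCoeff_mul [IsOrderedCancelAddMonoid Γ] {x y : SkewHahnSeries φ}
    (h : x.toHahnSeries.leadingCoeff *
      φ (ofAdd x.toHahnSeries.order) y.toHahnSeries.leadingCoeff ≠ 0) :
    (x * y).toHahnSeries.leadingCoeff =
      x.toHahnSeries.leadingCoeff *
        φ (ofAdd x.toHahnSeries.order) y.toHahnSeries.leadingCoeff := by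
  have hlead : x.toEnd.leadingCoeff * y.toEnd.leadingCoeff =
      monomialEnd φ (x.toHahnSeries.order + y.toHahnSeries.order)
        (x.toHahnSeries.leadingCoeff *
          φ (ofAdd x.toHahnSeries.order) y.toHahnSeries.leadingCoeff) := by
    rw [leadingCoeff_toEnd, leadingCoeff_toEnd, monomialEnd_mul_monomialEnd]
  have horder : (x * y).toHahnSeries.order = x.toHahnSeries.order + y.toHahnSeries.order := by
    rw [← order_toEnd, toEnd_mul, HahnSeries.order_mul_of_ne_zero, order_toEnd, order_toEnd]
    rw [hlead]
    exact (map_ne_zero_iff _ (monomialEnd_injective _)).2 h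
  rw [HahnSeries.leadingCoeff_eq, horder]
  apply monomialEnd_injective (φ := φ) (x.toHahnSeries.order + y.toHahnSeries.order)
  rw [← hlead, ← coeff_toEnd, toEnd_mul, ← order_toEnd x, ← order_toEnd y,
    HahnSeries.coeff_mul_order_add_order]

end LeadingCoeff

section DivisionRing

theorem isUnit_monomialEnd {Γ R : Type*} [AddGroup Γ] [DivisionRing R]
    (φ : Multiplicative Γ →* R →+* R) (i : Γ) {r : R} (hr : r ≠ 0) :
    IsUnit (monomialEnd φ i r) :=
  ((IsUnit.mk0 r hr).map (Module.toAddMonoidEnd R R)).mul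
    (((Group.isUnit (ofAdd i)).map φ).map (DistribMulAction.toAddMonoidEnd (R →+* R) R))

variable {R : Type*} [DivisionRing R] {φ : Multiplicative ℤ →* R →+* R}

theorem exists_mul_eq_one {x : SkewHahnSeries φ} (hx : x ≠ 0) : ∃ y, x * y = 1 := by
  have hlead : x.toHahnSeries.leadingCoeff ≠ 0 :=
    HahnSeries.leadingCoeff_ne_zero.2 fun h => hx (SkewHahnSeries.ext h)
  obtain ⟨y, hy⟩ := laurentSeries_exists_mul_eq_one
    (x.leadingCoeff_toEnd ▸ isUnit_monomialEnd φ x.toHahnSeries.order hlead)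
  exact ⟨evalOne φ y, by rw [mul_evalOne, hy, evalOne_one]⟩

instance : Nontrivial (SkewHahnSeries φ) :=
  (equivHahnSeries φ).nontrivial

open Classical in
noncomputable instance : DivisionRing (SkewHahnSeries φ) where
  inv x := if h : x = 0 then 0 else (exists_mul_eq_one h).choose
  mul_inv_cancel x h := by
    rw [dif_neg h]
    exact (exists_mul_eq_one h).choose_spec
  inv_zero := dif_pos rfl
  nnqsmul := _
  nnqsmul_def := fun _ _ => rfl
  qsmul := _
  qsmul_def := fun _ _ => rfl

end DivisionRing

end SkewHahnSeries

namespace HilbertNumber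

theorem coeff_twist (i : ℤ) (P : LaurentSeries ℝ) (k : ℤ) :
    (twist i P).coeff k = (2 : ℝ) ^ (i * k) * P.coeff k := rfl

theorem support_twist (i : ℤ) (P : LaurentSeries ℝ) : (twist i P).support = P.support := by
  ext k
  simp [coeff_twist, zpow_ne_zero]

theorem leadingCoeff_twist (i : ℤ) (P : LaurentSeries ℝ) :
    (twist i P).leadingCoeff = 2 ^ (i * P.order) * P.leadingCoeff := by
  rw [HahnSeries.leadingCoeff_eq, HahnSeries.leadingCoeff_eq,
    hahnSeries_order_eq_of_support_eq (support_twist i P), coeff_twist]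

theorem twist_single (i k : ℤ) (r : ℝ) :
    twist i (HahnSeries.single k r) = HahnSeries.single k (2 ^ (i * k) * r) := by
  ext l
  rw [coeff_twist, HahnSeries.coeff_single, HahnSeries.coeff_single]
  split_ifs with h
  · rw [h]
  · rw [mul_zero]

/-- The substitution `P(s) ↦ P(2ⁱ s)` as a ring endomorphism. -/
noncomputable def twistRingHom (i : ℤ) : LaurentSeries ℝ →+* LaurentSeries ℝ where
  toFun := twist i
  map_one' := by rw [← HahnSeries.single_zero_one, twist_single, mul_zero, zpow_zero, one_mul]
  map_zero' := by
    ext k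
    rw [coeff_twist, HahnSeries.coeff_zero, mul_zero]
  map_add' P Q := by
    ext k
    simp only [coeff_twist, HahnSeries.coeff_add, mul_add]
  map_mul' P Q := by
    ext k
    rw [coeff_twist, HahnSeries.coeff_mul, HahnSeries.coeff_mul, Finset.mul_sum]
    simp_rw [support_twist]
    refine Finset.sum_congr rfl fun ij hij => ?_
    rw [coeff_twist, coeff_twist, ← (Finset.mem_antidiagonal.1 hij).2.2, mul_add,
      zpow_add₀ two_ne_zero, mul_mul_mul_comm]

/-- The action `i ↦ (P(s) ↦ P(2ⁱ s))` of the powers of `t` on the Laurent series in `s`. -/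
noncomputable def twistHom : Multiplicative ℤ →* LaurentSeries ℝ →+* LaurentSeries ℝ where
  toFun i := twistRingHom i.toAdd
  map_one' := by
    ext P k
    change (2 : ℝ) ^ (0 * k) * P.coeff k = P.coeff k
    rw [zero_mul, zpow_zero, one_mul]
  map_mul' i j := by
    ext P k
    change (2 : ℝ) ^ ((i.toAdd + j.toAdd) * k) * P.coeff k =
      2 ^ (i.toAdd * k) * (2 ^ (j.toAdd * k) * P.coeff k)
    rw [add_mul, zpow_add₀ two_ne_zero, mul_assoc]

/-- The Hilbert numbers are the skew Hahn series in `t` over the Laurent series in `s` with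
`tⁱ P(s) = P(2ⁱ s) tⁱ`. -/
noncomputable def equivSkewHahnSeries : HilbertNumber ≃ SkewHahnSeries twistHom :=
  ⟨fun a => ⟨a.series⟩, fun x => ⟨x.toHahnSeries⟩, fun _ => rfl, fun _ => rfl⟩

noncomputable scoped instance : DivisionRing HilbertNumber := equivSkewHahnSeries.divisionRing

theorem add_eq_add (a b : HilbertNumber) : a + b = a.add b := rfl

theorem mul_eq_mul (a b : HilbertNumber) : a * b = a.mul b := rfl

theorem one_eq_ofReal : (1 : HilbertNumber) = ofReal 1 := rfl

theorem zero_eq_ofReal : (0 : HilbertNumber) = ofReal 0 := by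
  ext1
  rw [ofReal, HahnSeries.single_eq_zero, HahnSeries.single_eq_zero]
  rfl

theorem sub_eq_sub (a b : HilbertNumber) : a - b = a.sub b := rfl

/-- The additive embedding of the Hilbert numbers into the iterated series with lexicographic
order, from which the order is pulled back. -/
noncomputable def toLexSeries : HilbertNumber →+ Lex (HahnSeries ℤ (Lex (LaurentSeries ℝ))) where
  toFun a := toLex ⟨fun i => toLex (a.series.coeff i), a.series.isPWO_support⟩
  map_zero' := rfl
  map_add' _ _ := rfl

theorem toLexSeries_injective : Function.Injective toLexSeries := fun a b h => by
  ext1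
  ext1
  exact congrArg HahnSeries.coeff h

noncomputable scoped instance : LinearOrder HilbertNumber :=
  LinearOrder.lift' toLexSeries toLexSeries_injective

theorem leadingCoeff_toLexSeries (a : HilbertNumber) :
    (ofLex (toLexSeries a)).leadingCoeff = toLex a.series.leadingCoeff := by
  rw [HahnSeries.leadingCoeff_eq, HahnSeries.leadingCoeff_eq,
    hahnSeries_order_eq_of_support_eq (y := a.series) rfl]
  rfl

theorem zero_lt_iff_pos {a : HilbertNumber} : 0 < a ↔ a.Pos :=
  calc 0 < a ↔ 0 < toLexSeries a := by
        rw [← map_zero toLexSeries]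
        rfl
    _ ↔ 0 < toLex a.series.leadingCoeff := by
        rw [← HahnSeries.leadingCoeff_pos_iff, leadingCoeff_toLexSeries]
    _ ↔ a.Pos := HahnSeries.leadingCoeff_pos_iff.symm

scoped instance : IsOrderedAddMonoid HilbertNumber :=
  Function.Injective.isOrderedAddMonoid toLexSeries (fun _ _ => rfl) Iff.rfl

theorem lt_iff_pos_sub {a b : HilbertNumber} : a < b ↔ (b.sub a).Pos := by
  rw [← sub_pos, zero_lt_iff_pos, sub_eq_sub]

theorem Pos.mul {a b : HilbertNumber} (ha : a.Pos) (hb : b.Pos) : (a * b).Pos := by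
  have hpos : 0 < (a.series.leadingCoeff *
      twist a.series.order b.series.leadingCoeff).leadingCoeff := by
    rw [HahnSeries.leadingCoeff_mul, leadingCoeff_twist]
    exact mul_pos ha (mul_pos (zpow_pos two_pos _) hb)
  have hlead : (a * b).series.leadingCoeff =
      a.series.leadingCoeff * twist a.series.order b.series.leadingCoeff :=
    SkewHahnSeries.leadingCoeff_mul (x := equivSkewHahnSeries a) (y := equivSkewHahnSeries b)
      (HahnSeries.leadingCoeff_ne_zero.1 hpos.ne')
  rwa [Pos, hlead]

/-- The number `r sᵏ tⁱ`, as an additive function of the real number `r`. -/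
noncomputable def monomial (i k : ℤ) : ℝ →+ HilbertNumber where
  toFun r := ⟨HahnSeries.single i (HahnSeries.single k r)⟩
  map_zero' := by
    rw [HahnSeries.single_eq_zero, HahnSeries.single_eq_zero]
    rfl
  map_add' r q := by
    rw [HahnSeries.single_add, HahnSeries.single_add]
    rfl

theorem one_eq_monomial : (1 : HilbertNumber) = monomial 0 0 1 := rfl

theorem s_eq_monomial : s = monomial 0 1 1 := rfl

theorem t_eq_monomial : t = monomial 1 0 1 := rfl

theorem monomial_mul_monomial (i j k l : ℤ) (r q : ℝ) :
    monomial i k r * monomial j l q = monomial (i + j) (k + l) (r * (2 ^ (i * l) * q)) := by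
  apply equivSkewHahnSeries.injective
  refine (SkewHahnSeries.mk_single_mul_mk_single i j _ _).trans ?_
  change SkewHahnSeries.mk (HahnSeries.single (i + j)
    (HahnSeries.single k r * twist i (HahnSeries.single l q))) = _
  rw [twist_single, HahnSeries.single_mul_single]
  rfl

theorem monomial_pos (i k : ℤ) {r : ℝ} (hr : 0 < r) : 0 < monomial i k r := by
  change _ < HilbertNumber.mk _
  rw [zero_lt_iff_pos, Pos, HahnSeries.leadingCoeff_of_single, HahnSeries.leadingCoeff_of_single]
  exact hr

theorem monomial_lt_monomial {i j k l : ℤ} {r q : ℝ} (hq : 0 < q) (h : j < i ∨ j = i ∧ l < k) :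
    monomial i k r < monomial j l q := by
  have hne : HahnSeries.single l q ≠ 0 := mt HahnSeries.single_eq_zero_iff.1 hq.ne'
  change HilbertNumber.mk _ < HilbertNumber.mk _
  rw [lt_iff_pos_sub, sub, Pos]
  rcases h with hij | ⟨rfl, hlk⟩
  · rw [HahnSeries.leadingCoeff_sub, HahnSeries.leadingCoeff_of_single,
      HahnSeries.leadingCoeff_of_single]
    · exact hq
    · rw [HahnSeries.orderTop_single hne]
      exact HahnSeries.lt_orderTop_single hij
  · rw [← HahnSeries.single_sub, HahnSeries.leadingCoeff_of_single, HahnSeries.leadingCoeff_sub,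
      HahnSeries.leadingCoeff_of_single]
    · exact hq
    · rw [HahnSeries.orderTop_single hq.ne']
      exact HahnSeries.lt_orderTop_single hlk

theorem natCast_mul_monomial (n : ℕ) (i k : ℤ) (r : ℝ) :
    n * monomial i k r = monomial i k (n * r) := by
  rw [← nsmul_eq_mul, ← nsmul_eq_mul, map_nsmul]

scoped instance isStrictOrderedRing : IsStrictOrderedRing HilbertNumber :=
  haveI : ZeroLEOneClass HilbertNumber := ⟨(monomial_pos 0 0 one_pos).le⟩
  IsStrictOrderedRing.of_mul_pos fun _ _ ha hb =>
    zero_lt_iff_pos.2 ((zero_lt_iff_pos.1 ha).mul (zero_lt_iff_pos.1 hb))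

theorem s_pos : 0 < s := monomial_pos 0 1 one_pos

theorem t_pos : 0 < t := monomial_pos 1 0 one_pos

theorem natCast_mul_t_lt_s (m : ℕ) : m * t < s := by
  rw [t_eq_monomial, s_eq_monomial, natCast_mul_monomial]
  exact monomial_lt_monomial one_pos (Or.inl one_pos)

theorem natCast_mul_s_lt_one (n : ℕ) : n * s < 1 := by
  rw [s_eq_monomial, one_eq_monomial, natCast_mul_monomial]
  exact monomial_lt_monomial one_pos (Or.inr ⟨rfl, one_pos⟩)

theorem not_archimedean : ¬ Archimedean HilbertNumber := fun h => by
  obtain ⟨n, hn⟩ := h.arch 1 s_pos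
  rw [nsmul_eq_mul] at hn
  exact (natCast_mul_s_lt_one n).not_ge hn

theorem t_mul_s : t * s = 2 * (s * t) := by
  rw [s_eq_monomial, t_eq_monomial, monomial_mul_monomial, monomial_mul_monomial, two_mul,
    ← map_add]
  norm_num

theorem t_mul_s_ne_s_mul_t : t * s ≠ s * t := by
  rw [t_mul_s, two_mul]
  exact (lt_add_of_pos_left _ (mul_pos s_pos t_pos)).ne'

end HilbertNumber

namespace PlaneGeometry

open MulOpposite
open scoped RightActions

theorem Collinear.reverse {Pt Ln : Type*} {I : Pt → Ln → Prop} {A B C : Pt}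
    (h : Collinear I A B C) : Collinear I C B A :=
  h.imp fun _ h => ⟨h.2.2, h.2.1, h.1⟩

section DotProduct

variable {K ι : Type*} [DivisionRing K] [Fintype ι]

theorem exists_dotProduct_eq_one {p q : ι → K} (hq : q ≠ 0) (hpq : ∀ x : K, p ≠ q <• x) :
    ∃ u : ι → K, u ⬝ᵥ p = 1 ∧ u ⬝ᵥ q = 0 := by
  classical
  obtain ⟨i, hi⟩ := Function.ne_iff.1 hq
  obtain ⟨j, hj⟩ := Function.ne_iff.1 (hpq ((q i)⁻¹ * p i))
  have hz : p j - q j * ((q i)⁻¹ * p i) ≠ 0 := sub_ne_zero.2 hj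
  set z := p j - q j * ((q i)⁻¹ * p i) with hz_def
  refine ⟨Pi.single j z⁻¹ - Pi.single i (z⁻¹ * (q j * (q i)⁻¹)), ?_, ?_⟩
  · rw [sub_dotProduct, single_dotProduct, single_dotProduct, mul_assoc, ← mul_sub, mul_assoc,
      ← hz_def, inv_mul_cancel₀ hz]
  · rw [sub_dotProduct, single_dotProduct, single_dotProduct, mul_assoc, ← mul_sub, mul_assoc,
      inv_mul_cancel₀ hi, mul_one, sub_self, mul_zero]

/-- The pairing of row vectors with two given column vectors, as a linear map whose kernel
consists of the equations of the lines through both points. -/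
def pairing (p q : ι → K) : (ι → K) →ₗ[K] K × K :=
  ((dotProductBilin K Kᵐᵒᵖ).flip p).prod ((dotProductBilin K Kᵐᵒᵖ).flip q)

theorem pairing_apply (p q u : ι → K) : pairing p q u = (u ⬝ᵥ p, u ⬝ᵥ q) := rfl

theorem mem_ker_pairing {p q u : ι → K} :
    u ∈ LinearMap.ker (pairing p q) ↔ u ⬝ᵥ p = 0 ∧ u ⬝ᵥ q = 0 := by
  rw [LinearMap.mem_ker, pairing_apply, Prod.mk_eq_zero]

theorem exists_ne_zero_dotProduct_eq_zero (hι : 2 < Fintype.card ι) (p q : ι → K) :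
    ∃ u : ι → K, u ≠ 0 ∧ u ⬝ᵥ p = 0 ∧ u ⬝ᵥ q = 0 := by
  have hker : LinearMap.ker (pairing p q) ≠ ⊥ :=
    LinearMap.ker_ne_bot_of_finrank_lt (by
      rwa [Module.finrank_prod, Module.finrank_self, Module.finrank_fintype_fun_eq_card])
  obtain ⟨u, hu, hne⟩ := Submodule.exists_mem_ne_zero_of_ne_bot hker
  exact ⟨u, hne, mem_ker_pairing.1 hu⟩

theorem pairing_surjective {p q : ι → K} (hp : p ≠ 0) (hq : q ≠ 0)
    (hpq : ∀ x : K, p ≠ q <• x) (hqp : ∀ x : K, q ≠ p <• x) :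
    Function.Surjective (pairing p q) := by
  obtain ⟨u, hup, huq⟩ := exists_dotProduct_eq_one hq hpq
  obtain ⟨v, hvq, hvp⟩ := exists_dotProduct_eq_one hp hqp
  rintro ⟨x, y⟩
  refine ⟨x • u + y • v, ?_⟩
  simp [pairing_apply, add_dotProduct, hup, huq, hvp, hvq]

theorem eq_smul_of_dotProduct_eq_zero (hι : Fintype.card ι = 3) {p q u v : ι → K} (hp : p ≠ 0)
    (hq : q ≠ 0) (hpq : ∀ x : K, p ≠ q <• x) (hqp : ∀ x : K, q ≠ p <• x) (hv : v ≠ 0)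
    (hup : u ⬝ᵥ p = 0) (huq : u ⬝ᵥ q = 0) (hvp : v ⬝ᵥ p = 0) (hvq : v ⬝ᵥ q = 0) :
    ∃ x : K, u = x • v := by
  have hdim := LinearMap.finrank_range_add_finrank_ker (pairing p q)
  rw [LinearMap.range_eq_top.2 (pairing_surjective hp hq hpq hqp), finrank_top,
    Module.finrank_prod, Module.finrank_self, Module.finrank_fintype_fun_eq_card, hι] at hdim
  have hker : Module.finrank K (LinearMap.ker (pairing p q)) = 1 := by omega
  obtain ⟨x, hx⟩ := exists_smul_eq_of_finrank_eq_one hker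
    (x := ⟨v, mem_ker_pairing.2 ⟨hvp, hvq⟩⟩) (fun h0 => hv (congrArg Subtype.val h0))
    ⟨u, mem_ker_pairing.2 ⟨hup, huq⟩⟩
  exact ⟨x, (congrArg Subtype.val hx).symm⟩

end DotProduct

theorem sides_injective_of_not_collinear {Pt Ln : Type*} {I : Pt → Ln → Prop}
    {A : Fin 3 → Pt} {a : Fin 3 → Ln} (hA : ¬ Collinear I (A 0) (A 1) (A 2))
    (ha : ∀ i j, i ≠ j → I (A j) (a i)) : Function.Injective a := by
  intro i j hij
  by_contra hne
  have hall : ∀ k, I (A k) (a i) := fun k => by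
    by_cases hk : i = k
    · exact hij ▸ ha j k fun h => hne (hk.trans h.symm)
    · exact ha i k hk
  exact hA ⟨a i, hall 0, hall 1, hall 2⟩

/-- Homogeneous coordinates on an incidence structure: points are the nonzero column vectors up to
factors on the right, and lines are the nonzero row vectors up to factors on the left. -/
structure HomogeneousCoordinates (K : Type*) [DivisionRing K] {Pt Ln : Type*}
    (I : Pt → Ln → Prop) where
  pt : Pt → Fin 3 → K
  ln : Ln → Fin 3 → K
  pt_ne_zero : ∀ P, pt P ≠ 0
  ln_ne_zero : ∀ g, ln g ≠ 0
  incident_iff : ∀ P g, I P g ↔ ln g ⬝ᵥ pt P = 0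
  pt_inj : ∀ P Q (x : K), pt P = pt Q <• x → P = Q
  ln_inj : ∀ g h (x : K), ln g = x • ln h → g = h
  pt_surj : ∀ v, v ≠ 0 → ∃ P, ∃ x : K, v = pt P <• x
  ln_surj : ∀ v, v ≠ 0 → ∃ g, ∃ x : K, v = x • ln g

namespace HomogeneousCoordinates

variable {K : Type*} [DivisionRing K] {Pt Ln : Type*} {I : Pt → Ln → Prop}

/-- The coordinates of the dual structure, with points and lines exchanged. Rows become columns, so
the coordinates lie in the opposite skew field. -/
def dual (C : HomogeneousCoordinates K I) :
    HomogeneousCoordinates Kᵐᵒᵖ (fun g P => I P g) where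
  pt g i := op (C.ln g i)
  ln P i := op (C.pt P i)
  pt_ne_zero g h := C.ln_ne_zero g (funext fun i => op_injective (congrFun h i))
  ln_ne_zero P h := C.pt_ne_zero P (funext fun i => op_injective (congrFun h i))
  incident_iff g P := by
    rw [C.incident_iff P g, ← op_eq_zero_iff]
    simp only [dotProduct, Finset.op_sum, op_mul]
  pt_inj g h x hx := C.ln_inj g h (unop x) (funext fun i => op_injective (congrFun hx i))
  ln_inj P Q x hx := C.pt_inj P Q (unop x) (funext fun i => op_injective (congrFun hx i))
  pt_surj v hv := by
    obtain ⟨g, x, h⟩ := C.ln_surj (fun i => unop (v i))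
      fun h0 => hv (funext fun i => unop_injective (congrFun h0 i))
    exact ⟨g, op x, funext fun i => unop_injective (congrFun h i)⟩
  ln_surj v hv := by
    obtain ⟨P, x, h⟩ := C.pt_surj (fun i => unop (v i))
      fun h0 => hv (funext fun i => unop_injective (congrFun h0 i))
    exact ⟨P, op x, funext fun i => unop_injective (congrFun h i)⟩

variable (C : HomogeneousCoordinates K I)

include C

theorem exists_forall_incident_iff {u : Fin 3 → K} (hu : u ≠ 0) :
    ∃ g, ∀ P, I P g ↔ u ⬝ᵥ C.pt P = 0 := by
  obtain ⟨g, x, rfl⟩ := C.ln_surj u hu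
  have hx : x ≠ 0 := left_ne_zero_of_smul hu
  refine ⟨g, fun P => ?_⟩
  rw [C.incident_iff, smul_dotProduct, smul_eq_zero_iff_right hx]

theorem exists_line (P Q : Pt) : ∃ g, I P g ∧ I Q g := by
  obtain ⟨u, hu, hP, hQ⟩ := exists_ne_zero_dotProduct_eq_zero (by simp) (C.pt P) (C.pt Q)
  obtain ⟨g, hg⟩ := C.exists_forall_incident_iff hu
  exact ⟨g, (hg P).2 hP, (hg Q).2 hQ⟩

theorem line_unique {P Q : Pt} {g h : Ln} (hPQ : P ≠ Q) (hPg : I P g) (hQg : I Q g) (hPh : I P h)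
    (hQh : I Q h) : g = h := by
  rw [C.incident_iff] at *
  obtain ⟨x, hx⟩ := eq_smul_of_dotProduct_eq_zero (Fintype.card_fin 3) (C.pt_ne_zero P)
    (C.pt_ne_zero Q) (fun x hx => hPQ (C.pt_inj P Q x hx))
    (fun x hx => hPQ (C.pt_inj Q P x hx).symm) (C.ln_ne_zero h) hPg hQg hPh hQh
  exact C.ln_inj g h x hx

theorem exists_point (g h : Ln) : ∃ P, I P g ∧ I P h := C.dual.exists_line g h

theorem point_unique {P Q : Pt} {g h : Ln} (hgh : g ≠ h) (hPg : I P g) (hPh : I P h) (hQg : I Q g)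
    (hQh : I Q h) : P = Q :=
  C.dual.line_unique hgh hPg hPh hQg hQh

theorem eq_zero_of_pt_smul_eq_pt_smul {P Q : Pt} (hPQ : P ≠ Q) {x y : K}
    (h : C.pt P <• x = C.pt Q <• y) : x = 0 := by
  by_contra hx
  refine hPQ (C.pt_inj P Q (y * x⁻¹) ?_)
  rw [op_smul_mul, ← h, op_smul_op_smul, mul_inv_cancel₀ hx, op_one, one_smul]

theorem exists_eq_pt_smul {P : Pt} {g h : Ln} (hgh : g ≠ h) (hPg : I P g) (hPh : I P h)
    {v : Fin 3 → K} (hg : C.ln g ⬝ᵥ v = 0) (hh : C.ln h ⬝ᵥ v = 0) :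
    ∃ x : K, v = C.pt P <• x := by
  rcases eq_or_ne v 0 with rfl | hv
  · exact ⟨0, by rw [op_zero, zero_smul]⟩
  obtain ⟨Q, x, rfl⟩ := C.pt_surj v hv
  have hx : op x ≠ 0 := left_ne_zero_of_smul hv
  rw [dotProduct_smul, smul_eq_zero_iff_right hx, ← C.incident_iff] at hg hh
  exact ⟨x, by rw [C.point_unique hgh hg hh hPg hPh]⟩

theorem exists_pt_eq_add {P Q O : Pt} {g : Ln} (hPQ : P ≠ Q) (hP : I P g) (hQ : I Q g)
    (hO : I O g) : ∃ x y : K, C.pt O = C.pt P <• x + C.pt Q <• y := by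
  obtain ⟨u, huP, huQ⟩ := exists_dotProduct_eq_one (C.pt_ne_zero Q)
    (fun x hx => hPQ (C.pt_inj P Q x hx))
  have hu : u ≠ 0 := by
    rintro rfl
    exact zero_ne_one ((zero_dotProduct _).symm.trans huP)
  obtain ⟨h, hh⟩ := C.exists_forall_incident_iff hu
  have hPh : C.ln h ⬝ᵥ C.pt P ≠ 0 := fun h0 =>
    one_ne_zero (huP.symm.trans ((hh P).1 ((C.incident_iff P h).2 h0)))
  have hgh : g ≠ h := fun h0 => hPh ((C.incident_iff P h).1 (h0 ▸ hP))
  obtain ⟨y, hy⟩ := C.exists_eq_pt_smul hgh hQ ((hh Q).2 huQ)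
    (v := C.pt O - C.pt P <• ((C.ln h ⬝ᵥ C.pt P)⁻¹ * (C.ln h ⬝ᵥ C.pt O)))
    (by rw [dotProduct_sub, dotProduct_smul, (C.incident_iff _ _).1 hO,
      (C.incident_iff _ _).1 hP, smul_zero, sub_zero])
    (by rw [dotProduct_sub, dotProduct_smul, op_smul_eq_mul, mul_inv_cancel_left₀ hPh, sub_self])
  exact ⟨_, y, sub_eq_iff_eq_add'.1 hy⟩

theorem dotProduct_pt_smul_sub {P Q : Pt} {g : Ln} (hP : I P g) (hQ : I Q g) (x y : K) :
    C.ln g ⬝ᵥ (C.pt P <• x - C.pt Q <• y) = 0 := by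
  rw [dotProduct_sub, dotProduct_smul, dotProduct_smul, (C.incident_iff _ _).1 hP,
    (C.incident_iff _ _).1 hQ, smul_zero, smul_zero, sub_zero]

/-- The difference lies on the line `PQ` and, being also `Q'y' - P'x'`, on the line `P'Q'`. -/
theorem exists_pt_smul_eq_sub {P Q P' Q' X : Pt} {g g' : Ln} (hPQ : P ≠ Q) (hPQ' : P' ≠ Q')
    (hgg' : g ≠ g') (hP : I P g) (hQ : I Q g) (hX : I X g) (hP' : I P' g') (hQ' : I Q' g')
    (hX' : I X g') {x y x' y' : K} (hne : C.pt P <• x + C.pt P' <• x' ≠ 0)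
    (heq : C.pt P <• x + C.pt P' <• x' = C.pt Q <• y + C.pt Q' <• y') :
    ∃ z : K, z ≠ 0 ∧ C.pt P <• x - C.pt Q <• y = C.pt X <• z := by
  have hdiff : C.pt P <• x - C.pt Q <• y = C.pt Q' <• y' - C.pt P' <• x' := by
    rw [sub_eq_sub_iff_add_eq_add, heq, add_comm]
  obtain ⟨z, hz⟩ := C.exists_eq_pt_smul hgg' hX hX' (C.dotProduct_pt_smul_sub hP hQ x y)
    (hdiff ▸ C.dotProduct_pt_smul_sub hQ' hP' y' x')
  refine ⟨z, ?_, hz⟩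
  rintro rfl
  rw [op_zero, zero_smul] at hz
  have hx : x = 0 := C.eq_zero_of_pt_smul_eq_pt_smul hPQ (sub_eq_zero.1 hz)
  have hx' : x' = 0 :=
    C.eq_zero_of_pt_smul_eq_pt_smul hPQ' (sub_eq_zero.1 (hdiff.symm.trans hz)).symm
  exact hne (by rw [hx, hx', op_zero, zero_smul, zero_smul, add_zero])

theorem incident_of_pt_smul_add_eq_zero {P Q R : Pt} {g : Ln} (hP : I P g) (hQ : I Q g)
    {x y z : K} (hz : z ≠ 0) (h : C.pt P <• x + C.pt Q <• y + C.pt R <• z = 0) : I R g := by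
  have hdot := congrArg (C.ln g ⬝ᵥ ·) h
  simp only [dotProduct_add, dotProduct_smul, (C.incident_iff _ _).1 hP, (C.incident_iff _ _).1 hQ,
    smul_zero, zero_add, dotProduct_zero] at hdot
  exact (C.incident_iff R g).2 ((smul_eq_zero_iff_right ((op_ne_zero_iff z).2 hz)).1 hdot)

/-- If the center is `O = A i <• x i + A' i <• y i` for all `i`, then `A i <• x i - A j <• x j`
represents the point `X k`, and these three differences add up to zero. -/
theorem exists_axis {A A' : Fin 3 → Pt} {a a' c : Fin 3 → Ln} {X : Fin 3 → Pt}
    (hA : Function.Injective A) (hA' : Function.Injective A')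
    (ha : ∀ i j, i ≠ j → I (A j) (a i)) (ha' : ∀ i j, i ≠ j → I (A' j) (a' i))
    (hAA' : ∀ i, A i ≠ A' i) (haa' : ∀ i, a i ≠ a' i)
    (hc : ∀ i, I (A i) (c i) ∧ I (A' i) (c i)) (hX : ∀ i, I (X i) (a i) ∧ I (X i) (a' i))
    (hO : ∃ O, ∀ i, I O (c i)) : ∃ l, ∀ i, I (X i) l := by
  obtain ⟨O, hO⟩ := hO
  choose x y hxy using fun i => C.exists_pt_eq_add (hAA' i) (hc i).1 (hc i).2 (hO i)
  have exists_coord : ∀ i j k, i ≠ j → k ≠ i → k ≠ j → ∃ z : K, z ≠ 0 ∧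
      C.pt (A i) <• x i - C.pt (A j) <• x j = C.pt (X k) <• z := fun i j k hij hki hkj =>
    C.exists_pt_smul_eq_sub (hA.ne hij) (hA'.ne hij) (haa' k) (ha k i hki) (ha k j hkj) (hX k).1
      (ha' k i hki) (ha' k j hkj) (hX k).2 (hxy i ▸ C.pt_ne_zero O) ((hxy i).symm.trans (hxy j))
  obtain ⟨z₀, -, h₀⟩ := exists_coord 1 2 0 (by decide) (by decide) (by decide)
  obtain ⟨z₁, -, h₁⟩ := exists_coord 2 0 1 (by decide) (by decide) (by decide)
  obtain ⟨z₂, hz₂, h₂⟩ := exists_coord 0 1 2 (by decide) (by decide) (by decide)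
  obtain ⟨l, hl₀, hl₁⟩ := C.exists_line (X 0) (X 1)
  have hl₂ : I (X 2) l := C.incident_of_pt_smul_add_eq_zero hl₀ hl₁ hz₂ (by
    rw [← h₀, ← h₁, ← h₂]
    abel)
  exact ⟨l, Fin.forall_fin_succ.2 ⟨hl₀, Fin.forall_fin_two.2 ⟨hl₁, hl₂⟩⟩⟩

theorem injective_of_not_collinear {A : Fin 3 → Pt} (hA : ¬ Collinear I (A 0) (A 1) (A 2)) :
    Function.Injective A := by
  have exists_third : ∀ i j : Fin 3, i ≠ j → ∃ k, ∀ m, m = i ∨ m = j ∨ m = k := by decide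
  intro i j hij
  by_contra hne
  obtain ⟨k, hk⟩ := exists_third i j hne
  obtain ⟨g, hig, hkg⟩ := C.exists_line (A i) (A k)
  have hall : ∀ m, I (A m) g := fun m => by
    rcases hk m with rfl | rfl | rfl
    exacts [hig, hij ▸ hig, hkg]
  exact hA ⟨g, hall 0, hall 1, hall 2⟩

theorem desargues : Desargues I := fun _ _ _ _ _ _ hA hA' ha ha' hAA' haa' hc hX =>
  ⟨C.exists_axis (C.injective_of_not_collinear hA) (C.injective_of_not_collinear hA') ha ha'
      hAA' haa' hc hX,
    C.dual.exists_axis (sides_injective_of_not_collinear hA ha)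
      (sides_injective_of_not_collinear hA' ha') (fun i j h => ha j i h.symm)
      (fun i j h => ha' j i h.symm) haa' hAA' hX hc⟩

end HomogeneousCoordinates

end PlaneGeometry

namespace CoordPlane

open PlaneGeometry MulOpposite AffineMap
open scoped RightActions

section DivisionRing

variable {K : Type*} [DivisionRing K]

/-- The left-hand side `a x + b y` of the equation of the parallel through the origin, as a linear
map of right vector spaces. -/
def LineEq.linear (u : LineEq K) : K × K →ₗ[Kᵐᵒᵖ] K where
  toFun v := u.a * v.1 + u.b * v.2
  map_add' v w := by
    rw [Prod.fst_add, Prod.snd_add, mul_add, mul_add, add_add_add_comm]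
  map_smul' z v := by
    simp only [Prod.smul_fst, Prod.smul_snd, smul_eq_mul_unop, RingHom.id_apply, mul_assoc, add_mul]

/-- The left-hand side `a x + b y + c` of the equation of a line, as an affine map. -/
def LineEq.eval (u : LineEq K) : K × K →ᵃ[Kᵐᵒᵖ] K := u.linear.toAffineMap + const Kᵐᵒᵖ _ u.c

theorem LineEq.linear_apply (u : LineEq K) (v : K × K) : u.linear v = u.a * v.1 + u.b * v.2 := rfl

theorem LineEq.eval_apply (u : LineEq K) (P : K × K) : u.eval P = u.a * P.1 + u.b * P.2 + u.c := rfl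

theorem LineEq.linear_eq_mul {u v : LineEq K} {l : K} (ha : u.a = l * v.a) (hb : u.b = l * v.b)
    (w : K × K) : u.linear w = l * v.linear w := by
  rw [linear_apply, linear_apply, ha, hb, mul_add, mul_assoc, mul_assoc]

open Classical in
/-- A nonzero vector that spans the lines parallel to `a x + b y + c = 0`. -/
noncomputable def LineEq.direction (u : LineEq K) : K × K :=
  if u.a = 0 then (1, 0) else (-(u.a⁻¹ * u.b), 1)

theorem LineEq.direction_ne_zero (u : LineEq K) : u.direction ≠ 0 := by
  rw [direction]
  split_ifs <;> simp

theorem LineEq.linear_eq_zero_iff {u : LineEq K} {v : K × K} :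
    u.linear v = 0 ↔ ∃ z : K, v = u.direction <• z := by
  rw [linear_apply, direction]
  split_ifs with ha
  · have hb : u.b ≠ 0 := u.ne.resolve_left (not_not.2 ha)
    rw [ha, zero_mul, zero_add, mul_eq_zero_iff_left hb]
    constructor
    · exact fun h => ⟨v.1, Prod.ext (by simp) (by simp [h])⟩
    · rintro ⟨z, rfl⟩
      simp
  · constructor
    · refine fun h => ⟨v.2, Prod.ext ?_ (by simp)⟩
      rw [Prod.smul_fst, op_smul_eq_mul, neg_mul, mul_assoc, ← mul_neg,
        ← eq_neg_of_add_eq_zero_left h, inv_mul_cancel_left₀ ha]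
    · rintro ⟨z, rfl⟩
      simp [mul_assoc, ha]

theorem LineEq.linear_direction_eq_zero_iff {u v : LineEq K} :
    v.linear u.direction = 0 ↔ LineEq.sameDirection K v u := by
  constructor
  · intro h
    rw [linear_apply, direction] at h
    split_ifs at h with ha
    · have hb : u.b ≠ 0 := u.ne.resolve_left (not_not.2 ha)
      rw [mul_one, mul_zero, add_zero] at h
      exact ⟨v.b * u.b⁻¹, by rw [h, ha, mul_zero], by rw [inv_mul_cancel_right₀ hb]⟩
    · rw [mul_neg, mul_one, neg_add_eq_zero, ← mul_assoc] at h
      exact ⟨v.a * u.a⁻¹, by rw [inv_mul_cancel_right₀ ha], h.symm⟩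
  · rintro ⟨l, ha, hb⟩
    have hu : u.linear u.direction = 0 :=
      linear_eq_zero_iff.2 ⟨1, by rw [op_one, one_smul]⟩
    rw [linear_eq_mul ha hb, hu, mul_zero]

theorem LineEq.exists_linear_eq_zero (v : K × K) : ∃ u : LineEq K, u.linear v = 0 := by
  by_cases hv : v.2 = 0
  · exact ⟨⟨0, 1, 0, Or.inr one_ne_zero⟩, by simp [linear_apply, hv]⟩
  · exact ⟨⟨1, -(v.1 * v.2⁻¹), 0, Or.inl one_ne_zero⟩, by simp [linear_apply, hv]⟩

/-- An equation of a line. -/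
noncomputable def Line.eqn (g : Line K) : LineEq K := Quotient.out (s := LineEq.sameLine K) g

theorem Line.mk_eqn (g : Line K) : Line.mk g.eqn.a g.eqn.b g.eqn.c g.eqn.ne = g :=
  Quotient.out_eq (s := LineEq.sameLine K) g

theorem Line.exists_eqn (g : Line K) : ∃ u : LineEq K, g = Line.mk u.a u.b u.c u.ne :=
  ⟨g.eqn, g.mk_eqn.symm⟩

theorem lies_mk {P : K × K} {a b c : K} {h : a ≠ 0 ∨ b ≠ 0} :
    Lies P (Line.mk a b c h) ↔ a * P.1 + b * P.2 + c = 0 := Iff.rfl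

theorem lies_eqn {P : K × K} {u : LineEq K} :
    Lies P (Line.mk u.a u.b u.c u.ne) ↔ u.eval P = 0 := Iff.rfl

theorem improper_mk_eq_iff {a b c a' b' c' : K} {h : a ≠ 0 ∨ b ≠ 0} {h' : a' ≠ 0 ∨ b' ≠ 0} :
    (Line.mk a b c h).improper = (Line.mk a' b' c' h').improper ↔
      ∃ l, a = l * a' ∧ b = l * b' :=
  Quotient.eq (r := LineEq.sameDirection K)

theorem mk_eq_iff {a b c a' b' c' : K} {h : a ≠ 0 ∨ b ≠ 0} {h' : a' ≠ 0 ∨ b' ≠ 0} :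
    Line.mk a b c h = Line.mk a' b' c' h' ↔ ∃ l, a = l * a' ∧ b = l * b' ∧ c = l * c' :=
  Quotient.eq (r := LineEq.sameLine K)

theorem Lies.lineMap {P Q : K × K} {g : Line K} (hP : Lies P g) (hQ : Lies Q g) (r : K) :
    Lies (lineMap P Q (op r)) g := by
  obtain ⟨u, rfl⟩ := g.exists_eqn
  rw [lies_eqn] at *
  rw [apply_lineMap, hP, hQ, lineMap_same_apply]

/-- An equation of some line of a parallel class. -/
noncomputable def ImproperPoint.eqn (d : ImproperPoint K) : LineEq K :=
  Quotient.out (s := LineEq.sameDirection K) d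

theorem ImproperPoint.mk_eqn (d : ImproperPoint K) :
    Quotient.mk (LineEq.sameDirection K) d.eqn = d :=
  Quotient.out_eq (s := LineEq.sameDirection K) d

theorem lies_iff_eval_eqn {P : K × K} {g : Line K} : Lies P g ↔ g.eqn.eval P = 0 := by
  rw [← lies_eqn, g.mk_eqn]

theorem improper_eq_iff_linear_eqn {g : Line K} {d : ImproperPoint K} :
    g.improper = d ↔ g.eqn.linear d.eqn.direction = 0 := by
  rw [LineEq.linear_direction_eq_zero_iff]
  conv_lhs => rw [← g.mk_eqn, ← d.mk_eqn]
  exact Quotient.eq (r := LineEq.sameDirection K)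

/-- Homogeneous coordinates of a point of the extended plane. -/
noncomputable def ExtPoint.vec : ExtPoint K → Fin 3 → K
  | .proper P => ![P.1, P.2, 1]
  | .improper d => ![d.eqn.direction.1, d.eqn.direction.2, 0]

/-- Homogeneous coordinates of a line of the extended plane. -/
noncomputable def ExtLine.vec : ExtLine K → Fin 3 → K
  | .proper g => ![g.eqn.a, g.eqn.b, g.eqn.c]
  | .infinity => ![0, 0, 1]

theorem vec3_eq_iff {M : Type*} {v : Fin 3 → M} {a b c : M} :
    v = ![a, b, c] ↔ v 0 = a ∧ v 1 = b ∧ v 2 = c := by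
  rw [funext_iff, Fin.forall_fin_succ, Fin.forall_fin_two]
  rfl

theorem ExtPoint.vec_ne_zero (P : ExtPoint K) : P.vec ≠ 0 := by
  intro h
  cases P with
  | proper P => exact zero_ne_one (vec3_eq_iff.1 h.symm).2.2
  | improper d =>
    have h' := vec3_eq_iff.1 h.symm
    exact d.eqn.direction_ne_zero (Prod.ext h'.1.symm h'.2.1.symm)

theorem ExtLine.vec_ne_zero (g : ExtLine K) : g.vec ≠ 0 := by
  intro h
  cases g with
  | proper g =>
    have h' := vec3_eq_iff.1 h.symm
    exact g.eqn.ne.elim (fun ha => ha h'.1.symm) fun hb => hb h'.2.1.symm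
  | infinity => exact zero_ne_one (vec3_eq_iff.1 h.symm).2.2

theorem extLies_iff (P : ExtPoint K) (g : ExtLine K) : ExtLies P g ↔ g.vec ⬝ᵥ P.vec = 0 := by
  rcases P with P | d <;> rcases g with g | _ <;> rw [ExtPoint.vec, ExtLine.vec,
    Matrix.vec3_dotProduct']
  · rw [ExtLies, lies_iff_eval_eqn, LineEq.eval_apply, mul_one]
  · simp [ExtLies]
  · rw [ExtLies, improper_eq_iff_linear_eqn, LineEq.linear_apply, mul_zero, add_zero]
  · simp [ExtLies]

theorem ExtPoint.vec_inj (P Q : ExtPoint K) (x : K) (h : P.vec = Q.vec <• x) : P = Q := by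
  rcases P with P | d <;> rcases Q with Q | e <;>
    obtain ⟨h0, h1, h2⟩ := vec3_eq_iff.1 h.symm
  · obtain rfl : x = 1 := (one_mul x).symm.trans h2
    exact congrArg _ (Prod.ext ((mul_one _).symm.trans h0).symm ((mul_one _).symm.trans h1).symm)
  · exact (zero_ne_one ((zero_mul x).symm.trans h2)).elim
  · obtain rfl : x = 0 := (one_mul x).symm.trans h2
    exact (d.eqn.direction_ne_zero (Prod.ext (h0.symm.trans (mul_zero _))
      (h1.symm.trans (mul_zero _)))).elim
  · have hdir : e.eqn.linear d.eqn.direction = 0 :=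
      LineEq.linear_eq_zero_iff.2 ⟨x, Prod.ext h0.symm h1.symm⟩
    rw [LineEq.linear_direction_eq_zero_iff] at hdir
    rw [← d.mk_eqn, ← e.mk_eqn]
    exact congrArg _ (Quotient.sound (s := LineEq.sameDirection K) hdir).symm

theorem ExtLine.vec_inj (g h : ExtLine K) (x : K) (hx : g.vec = x • h.vec) : g = h := by
  rcases g with g | _ <;> rcases h with h | _
  · obtain ⟨h0, h1, h2⟩ := vec3_eq_iff.1 hx.symm
    rw [← g.mk_eqn, ← h.mk_eqn]
    exact congrArg _ (mk_eq_iff.2 ⟨x, h0.symm, h1.symm, h2.symm⟩)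
  · obtain ⟨h0, h1, -⟩ := vec3_eq_iff.1 hx.symm
    exact (g.eqn.ne.elim (fun ha => ha (h0.symm.trans (mul_zero x)))
      fun hb => hb (h1.symm.trans (mul_zero x))).elim
  · obtain ⟨h0, h1, h2⟩ := vec3_eq_iff.1 hx.symm
    have hx0 : x = 0 := h.eqn.ne.elim (mul_eq_zero.1 h0).resolve_right
      (mul_eq_zero.1 h1).resolve_right
    rw [hx0, zero_smul] at h2
    exact (zero_ne_one h2).elim
  · rfl

theorem ExtPoint.vec_surj (v : Fin 3 → K) : ∃ P : ExtPoint K, ∃ x : K, v = P.vec <• x := by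
  by_cases h2 : v 2 = 0
  · obtain ⟨u, hu⟩ := LineEq.exists_linear_eq_zero (v 0, v 1)
    let d : ImproperPoint K := Quotient.mk (LineEq.sameDirection K) u
    obtain ⟨l, ha, hb⟩ : LineEq.sameDirection K d.eqn u :=
      Quotient.exact (s := LineEq.sameDirection K) d.mk_eqn
    obtain ⟨z, hz⟩ : ∃ z : K, (v 0, v 1) = d.eqn.direction <• z := LineEq.linear_eq_zero_iff.1
      (by rw [LineEq.linear_eq_mul ha hb, hu, mul_zero])
    refine ⟨.improper d, z, ?_⟩
    rw [vec, Matrix.smul_vec3, vec3_eq_iff]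
    exact ⟨congrArg Prod.fst hz, congrArg Prod.snd hz, h2.trans (smul_zero _).symm⟩
  · refine ⟨.proper (v 0 * (v 2)⁻¹, v 1 * (v 2)⁻¹), v 2, ?_⟩
    rw [vec, Matrix.smul_vec3, vec3_eq_iff]
    simp [h2]

theorem ExtLine.vec_surj (v : Fin 3 → K) : ∃ g : ExtLine K, ∃ x : K, v = x • g.vec := by
  by_cases h : v 0 ≠ 0 ∨ v 1 ≠ 0
  · let g : Line K := Line.mk (v 0) (v 1) (v 2) h
    obtain ⟨x, hx⟩ := mk_eq_iff.1 g.mk_eqn.symm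
    refine ⟨.proper g, x, ?_⟩
    rw [vec, Matrix.smul_vec3, vec3_eq_iff]
    exact hx
  · rw [not_or, not_not, not_not] at h
    refine ⟨.infinity, v 2, ?_⟩
    rw [vec, Matrix.smul_vec3, vec3_eq_iff]
    simp [h]

variable (K) in
/-- The homogeneous coordinates of the extended plane. -/
noncomputable def extCoordinates : HomogeneousCoordinates K (ExtLies (K := K)) where
  pt := ExtPoint.vec
  ln := ExtLine.vec
  pt_ne_zero := ExtPoint.vec_ne_zero
  ln_ne_zero := ExtLine.vec_ne_zero
  incident_iff := extLies_iff
  pt_inj := ExtPoint.vec_inj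
  ln_inj := ExtLine.vec_inj
  pt_surj v _ := ExtPoint.vec_surj v
  ln_surj v _ := ExtLine.vec_surj v

theorem line_unique {P Q : K × K} {g h : Line K} (hPQ : P ≠ Q) (hPg : Lies P g) (hQg : Lies Q g)
    (hPh : Lies P h) (hQh : Lies Q h) : g = h :=
  ExtLine.proper.inj ((extCoordinates K).line_unique (P := .proper P) (Q := .proper Q)
    (fun h => hPQ (ExtPoint.proper.inj h)) hPg hQg hPh hQh)

theorem collinear_proper_iff {P Q R : K × K} :
    Collinear ExtLies (.proper P) (.proper Q) (.proper R) ↔ Collinear Lies P Q R := by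
  constructor
  · rintro ⟨g | _, hP, hQ, hR⟩
    · exact ⟨g, hP, hQ, hR⟩
    · exact hP.elim
  · rintro ⟨g, h⟩
    exact ⟨.proper g, h⟩

theorem not_collinear_of_lies {P Q R : K × K} {g : Line K} (hPQ : P ≠ Q) (hP : Lies P g)
    (hQ : Lies Q g) (hR : ¬ Lies R g) : ¬ Collinear Lies P Q R := by
  rintro ⟨h, hP', hQ', hR'⟩
  exact hR (line_unique hPQ hP hQ hP' hQ' ▸ hR')

variable (K) in
/-- The `x`-axis. -/
def xAxis : Line K := Line.mk 0 1 0 (Or.inr one_ne_zero)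

variable (K) in
/-- The `y`-axis. -/
def yAxis : Line K := Line.mk 1 0 0 (Or.inl one_ne_zero)

theorem lies_xAxis_iff {P : K × K} : Lies P (xAxis K) ↔ P.2 = 0 := by
  rw [xAxis, lies_mk, zero_mul, one_mul, zero_add, add_zero]

theorem lies_yAxis_iff {P : K × K} : Lies P (yAxis K) ↔ P.1 = 0 := by
  rw [yAxis, lies_mk, zero_mul, one_mul, add_zero, add_zero]

theorem projectiveIncidence_extLies : ProjectiveIncidence (ExtLies (K := K)) where
  line A B hAB := by
    obtain ⟨g, hA, hB⟩ := (extCoordinates K).exists_line A B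
    exact ⟨g, ⟨hA, hB⟩, fun h hh => (extCoordinates K).line_unique hAB hh.1 hh.2 hA hB⟩
  point g h hgh := by
    obtain ⟨A, hg, hh⟩ := (extCoordinates K).exists_point g h
    exact ⟨A, ⟨hg, hh⟩, fun B hB => (extCoordinates K).point_unique hgh hB.1 hB.2 hg hh⟩
  quadrangle := by
    refine ⟨.proper (0, 0), .proper (1, 0), .proper (0, 1), .proper (1, 1), ?_, ?_, ?_, ?_⟩ <;>
      rw [collinear_proper_iff]
    · exact not_collinear_of_lies (g := xAxis K) (by simp) (by simp [lies_xAxis_iff])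
        (by simp [lies_xAxis_iff]) (by simp [lies_xAxis_iff])
    · exact not_collinear_of_lies (g := xAxis K) (by simp) (by simp [lies_xAxis_iff])
        (by simp [lies_xAxis_iff]) (by simp [lies_xAxis_iff])
    · exact not_collinear_of_lies (g := yAxis K) (by simp) (by simp [lies_yAxis_iff])
        (by simp [lies_yAxis_iff]) (by simp [lies_yAxis_iff])
    · exact not_collinear_of_lies (g := Line.mk 1 1 (-1) (Or.inl one_ne_zero)) (by simp)
        (by simp [lies_mk]) (by simp [lies_mk]) (by simp [lies_mk])

theorem exists_two_points (g : Line K) : ∃ P Q, P ≠ Q ∧ Lies P g ∧ Lies Q g := by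
  obtain ⟨⟨a, b, c, h⟩, rfl⟩ := g.exists_eqn
  by_cases ha : a = 0
  · have hb : b ≠ 0 := h.resolve_left (not_not.2 ha)
    exact ⟨(0, -(b⁻¹ * c)), (1, -(b⁻¹ * c)), by simp, by simp [lies_mk, hb],
      by simp [lies_mk, ha, hb]⟩
  · exact ⟨(-(a⁻¹ * c), 0), (-(a⁻¹ * (b + c)), 1), by simp, by simp [lies_mk, ha],
      by simp [lies_mk, ha]⟩

theorem incidenceAxioms_lies : IncidenceAxioms (Lies (K := K)) where
  exists_line A B _ := by
    obtain ⟨g | _, hA, hB⟩ := (extCoordinates K).exists_line (.proper A) (.proper B)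
    · exact ⟨g, hA, hB⟩
    · exact hA.elim
  line_unique _ _ _ _ := line_unique
  two_points := exists_two_points
  three_points := ⟨(0, 0), (1, 0), (0, 1), by simp, by simp, by simp,
    not_collinear_of_lies (g := xAxis K) (by simp) (by simp [lies_xAxis_iff])
      (by simp [lies_xAxis_iff]) (by simp [lies_xAxis_iff])⟩

theorem improper_ne_of_lies {P : K × K} {g h : Line K} (hgh : g ≠ h) (hg : Lies P g)
    (hh : Lies P h) : g.improper ≠ h.improper := fun heq => by
  have : ExtPoint.proper P = .improper h.improper :=
    (extCoordinates K).point_unique (g := .proper g) (h := .proper h)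
      (fun h => hgh (ExtLine.proper.inj h)) hg hh heq rfl
  cases this

theorem exists_lies_of_improper_ne {g h : Line K} (hgh : g.improper ≠ h.improper) :
    ∃ P, Lies P g ∧ Lies P h := by
  obtain ⟨P | d, hg, hh⟩ := (extCoordinates K).exists_point (.proper g) (.proper h)
  · exact ⟨P, hg, hh⟩
  · exact (hgh (Eq.trans hg (Eq.symm hh))).elim

theorem parallel_iff_not_exists_lies {g h : Line K} (hgh : g ≠ h) :
    Parallel g h ↔ ¬ ∃ P, Lies P g ∧ Lies P h := by
  constructor
  · rintro ⟨-, hd⟩ ⟨P, hg, hh⟩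
    exact improper_ne_of_lies hgh hg hh hd
  · intro h0
    exact ⟨hgh, not_imp_comm.1 exists_lies_of_improper_ne h0⟩

/-- The parallel is the line through `P` and the improper point of `g`. -/
theorem parallelPostulate_lies : ParallelPostulate (Lies (K := K)) := by
  intro P g hP
  have ne_of_lies : ∀ {k : Line K}, Lies P k → g ≠ k := fun hk hgk => hP (hgk ▸ hk)
  obtain ⟨h | _, hPh, hd⟩ :=
    (extCoordinates K).exists_line (.proper P) (.improper g.improper)
  · refine ⟨h, ⟨hPh, fun Q hQ => improper_ne_of_lies (ne_of_lies hPh) hQ.1 hQ.2 (Eq.symm hd)⟩, ?_⟩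
    rintro k ⟨hPk, hk⟩
    have hpar : Parallel g k :=
      (parallel_iff_not_exists_lies (ne_of_lies hPk)).2 fun ⟨Q, hQ⟩ => hk Q hQ
    exact ExtLine.proper.inj ((extCoordinates K).line_unique (P := .proper P)
      (Q := .improper g.improper) (fun h => by cases h) hPk hpar.2.symm hPh hd)
  · exact hPh.elim

theorem fst_eq_of_lies {P Q R : K × K} {g : Line K} (hP : Lies P g) (hQ : Lies Q g)
    (hR : Lies R g) (hPQ : P ≠ Q) (h : P.1 = Q.1) : R.1 = P.1 := by
  have hg : g = Line.mk 1 0 (-P.1) (Or.inl one_ne_zero) :=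
    line_unique hPQ hP hQ (by simp [lies_mk]) (by simp [lies_mk, h])
  rw [hg, lies_mk, one_mul, zero_mul, add_zero, ← sub_eq_add_neg] at hR
  exact sub_eq_zero.1 hR

theorem exists_eq_lineMap {x z : K} (h : x ≠ z) (y : K) : ∃ r : K, y = lineMap x z (op r) :=
  ⟨(z - x)⁻¹ * (y - x), by
    rw [lineMap_apply, vsub_eq_sub, vadd_eq_add, op_smul_eq_mul,
      mul_inv_cancel_left₀ (sub_ne_zero.2 h.symm), sub_add_cancel]⟩

theorem Lies.exists_eq_lineMap {P Q X : K × K} {g : Line K} (hP : Lies P g) (hQ : Lies Q g)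
    (hPQ : P ≠ Q) (hX : Lies X g) : ∃ r : K, X = AffineMap.lineMap P Q (op r) := by
  obtain ⟨u, rfl⟩ := g.exists_eqn
  rw [lies_eqn] at hP hQ hX
  have linear_sub : ∀ {Y}, u.eval Y = 0 → u.linear (Y - P) = 0 := fun {Y} hY => by
    rw [map_sub, ← sub_eq_zero.2 (hY.trans hP.symm), LineEq.eval_apply, LineEq.eval_apply,
      LineEq.linear_apply, LineEq.linear_apply, add_sub_add_right_eq_sub]
  obtain ⟨z, hz⟩ := LineEq.linear_eq_zero_iff.1 (linear_sub hQ)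
  obtain ⟨w, hw⟩ := LineEq.linear_eq_zero_iff.1 (linear_sub hX)
  have hz0 : z ≠ 0 := by
    rintro rfl
    rw [op_zero, zero_smul, sub_eq_zero] at hz
    exact hPQ hz.symm
  refine ⟨z⁻¹ * w, ?_⟩
  rw [lineMap_apply, vsub_eq_sub, vadd_eq_add, hz, smul_smul, ← op_mul, mul_inv_cancel_left₀ hz0,
    ← hw, sub_add_cancel]

end DivisionRing

section NumBetween

variable {K : Type*} [LinearOrder K] {x y z : K}

theorem NumBetween.symm (h : NumBetween x y z) : NumBetween z y x :=
  h.elim (fun h => Or.inr ⟨h.2, h.1⟩) fun h => Or.inl ⟨h.2, h.1⟩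

theorem NumBetween.ne (h : NumBetween x y z) : x ≠ y ∧ x ≠ z ∧ y ≠ z :=
  h.elim (fun h => ⟨h.1.ne, (h.1.trans h.2).ne, h.2.ne⟩)
    fun h => ⟨h.1.ne', (h.2.trans h.1).ne', h.2.ne'⟩

theorem NumBetween.not_rotate (h : NumBetween x y z) : ¬ NumBetween y z x := by
  rintro (h' | h') <;> rcases h with h | h
  · exact lt_asymm (h.1.trans h.2) h'.2
  · exact lt_asymm h.2 h'.1
  · exact lt_asymm h.2 h'.1
  · exact lt_asymm (h.2.trans h.1) h'.2

theorem numBetween_total (hxy : x ≠ y) (hxz : x ≠ z) (hyz : y ≠ z) :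
    NumBetween x y z ∨ NumBetween y z x ∨ NumBetween z x y := by
  grind [NumBetween]

theorem NumBetween.left_or_right (h : NumBetween x y z) {w : K} (hw : w ≠ y) :
    NumBetween x y w ∨ NumBetween z y w :=
  hw.lt_or_gt.elim
    (fun hw => h.elim (fun h => Or.inr (Or.inr ⟨h.2, hw⟩)) fun h => Or.inl (Or.inr ⟨h.1, hw⟩))
    fun hw => h.elim (fun h => Or.inl (Or.inl ⟨h.1, hw⟩)) fun h => Or.inr (Or.inl ⟨h.2, hw⟩)

end NumBetween

section Order

variable {K : Type*} [DivisionRing K] [LinearOrder K] {P Q R : K × K}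

theorem between_of_toLex_lt (h : Collinear Lies P Q R) (hPQ : toLex P < toLex Q)
    (hQR : toLex Q < toLex R) : Between P Q R := by
  have hPQne : P ≠ Q := fun e => hPQ.ne (congrArg toLex e)
  have hQRne : Q ≠ R := fun e => hQR.ne (congrArg toLex e)
  obtain ⟨g, hP, hQ, hR⟩ := h
  refine ⟨⟨g, hP, hQ, hR⟩, ?_⟩
  rcases Prod.Lex.toLex_lt_toLex.1 hPQ with hPQ | ⟨ePQ, hPQ⟩ <;>
    rcases Prod.Lex.toLex_lt_toLex.1 hQR with hQR | ⟨eQR, hQR⟩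
  · exact Or.inl (Or.inl ⟨hPQ, hQR⟩)
  · exact absurd (fst_eq_of_lies hQ hR hP hQRne eQR) hPQ.ne
  · exact absurd (fst_eq_of_lies hP hQ hR hPQne ePQ) (ePQ.trans_lt hQR).ne'
  · exact Or.inr ⟨ePQ, eQR, Or.inl ⟨hPQ, hQR⟩⟩

theorem Between.symm (h : Between P Q R) : Between R Q P :=
  ⟨h.1.reverse, h.2.imp NumBetween.symm fun h => ⟨h.2.1.symm, h.1.symm, h.2.2.symm⟩⟩

theorem between_iff_toLex :
    Between P Q R ↔ Collinear Lies P Q R ∧ NumBetween (toLex P) (toLex Q) (toLex R) := by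
  refine ⟨fun h => ⟨h.1, ?_⟩, ?_⟩
  · simp only [NumBetween, gt_iff_lt, Prod.Lex.toLex_lt_toLex]
    rcases h.2 with (h | h) | ⟨ePQ, eQR, h | h⟩
    · exact Or.inl ⟨Or.inl h.1, Or.inl h.2⟩
    · exact Or.inr ⟨Or.inl h.1, Or.inl h.2⟩
    · exact Or.inl ⟨Or.inr ⟨ePQ, h.1⟩, Or.inr ⟨eQR, h.2⟩⟩
    · exact Or.inr ⟨Or.inr ⟨ePQ.symm, h.1⟩, Or.inr ⟨eQR.symm, h.2⟩⟩
  · rintro ⟨hcol, h | h⟩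
    · exact between_of_toLex_lt hcol h.1 h.2
    · exact (between_of_toLex_lt hcol.reverse h.2 h.1).symm

variable [IsStrictOrderedRing K]

theorem numBetween_lineMap_iff_of_lt {x z r : K} (h : x < z) :
    NumBetween x (lineMap x z (op r)) z ↔ 0 < r ∧ r < 1 := by
  have hzx : 0 < z - x := sub_pos.2 h
  have hpos : x < lineMap x z (op r) ↔ 0 < r := by
    rw [lineMap_apply, vsub_eq_sub, vadd_eq_add, op_smul_eq_mul, lt_add_iff_pos_left,
      mul_pos_iff_of_pos_left hzx]
  have hlt : lineMap x z (op r) < z ↔ r < 1 := by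
    rw [lineMap_apply, vsub_eq_sub, vadd_eq_add, op_smul_eq_mul, ← lt_sub_iff_add_lt,
      mul_lt_iff_lt_one_right hzx]
  rw [← hpos, ← hlt]
  exact or_iff_left fun h' => h.not_gt (h'.2.trans h'.1)

theorem numBetween_lineMap_iff {x z r : K} (h : x ≠ z) :
    NumBetween x (lineMap x z (op r)) z ↔ 0 < r ∧ r < 1 := by
  rcases h.lt_or_gt with h | h
  · exact numBetween_lineMap_iff_of_lt h
  · have hr : lineMap x z (op r) = lineMap z x (op (1 - r)) := by
      rw [op_sub, op_one, lineMap_apply_one_sub]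
    have hrev := numBetween_lineMap_iff_of_lt (r := 1 - r) h
    rw [sub_pos, sub_lt_self_iff, and_comm] at hrev
    rw [hr, ← hrev]
    exact ⟨NumBetween.symm, NumBetween.symm⟩

theorem between_lineMap_iff (hPQ : P ≠ Q) {r : K} :
    Between P (lineMap P Q (op r)) Q ↔ 0 < r ∧ r < 1 := by
  obtain ⟨g, hP, hQ⟩ := incidenceAxioms_lies.exists_line P Q hPQ
  have hcol : Collinear Lies P (lineMap P Q (op r)) Q := ⟨g, hP, hP.lineMap hQ r, hQ⟩
  rw [Between, and_iff_right hcol, fst_lineMap, snd_lineMap]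
  by_cases h : P.1 = Q.1
  · rw [← h, lineMap_same_apply, numBetween_lineMap_iff fun h' => hPQ (Prod.ext h h')]
    simp [NumBetween]
  · rw [numBetween_lineMap_iff h, or_iff_left fun h' => h (h'.1.trans h'.2.1)]

theorem exists_beyond (hPQ : P ≠ Q) : ∃ R, Between P Q R := by
  set R : K × K := lineMap P Q (op (2 : K)) with hR
  have hQ : lineMap P R (op (2⁻¹ : K)) = Q := by
    rw [hR, lineMap_lineMap_right, ← op_mul, mul_inv_cancel₀ two_ne_zero, op_one, lineMap_apply_one]
  have hPR : P ≠ R := fun h => hPQ (by rw [← hQ, ← h, lineMap_same_apply])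
  refine ⟨R, ?_⟩
  rw [← hQ]
  exact (between_lineMap_iff hPR).2 ⟨by positivity, inv_lt_one_of_one_lt₀ one_lt_two⟩

theorem exists_lies_between_iff {u : LineEq K} (hP : u.eval P ≠ 0) :
    (∃ X, Lies X (Line.mk u.a u.b u.c u.ne) ∧ Between P X Q) ↔
      NumBetween (u.eval P) 0 (u.eval Q) := by
  simp only [lies_eqn]
  constructor
  · rintro ⟨X, hX, hPXQ⟩
    have hPQ := (between_iff_toLex.1 hPXQ).2.ne.2.1.imp (congrArg toLex)
    obtain ⟨g, hPg, hXg, hQg⟩ := hPXQ.1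
    obtain ⟨r, rfl⟩ := hPg.exists_eq_lineMap hQg hPQ hXg
    rw [apply_lineMap] at hX
    have hne : u.eval P ≠ u.eval Q := fun h => hP (by rwa [← h, lineMap_same_apply] at hX)
    rwa [← hX, numBetween_lineMap_iff hne, ← between_lineMap_iff hPQ]
  · intro h
    obtain ⟨r, hr⟩ := exists_eq_lineMap h.ne.2.1 0
    have hPQ : P ≠ Q := fun e => h.ne.2.1 (congrArg _ e)
    refine ⟨lineMap P Q (op r), ?_, ?_⟩
    · rw [apply_lineMap, ← hr]
    · rwa [between_lineMap_iff hPQ, ← numBetween_lineMap_iff h.ne.2.1, ← hr]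

theorem orderAxioms_lies_between : OrderAxioms (Lies (K := K)) Between where
  between_distinct P Q R h := (between_iff_toLex.1 h).2.ne
  between_collinear P Q R h := h.1
  between_symm P Q R h := h.symm
  extend P Q hPQ := exists_beyond hPQ
  exists_between P Q R hPQ hPR hQR := by
    rintro ⟨g, hP, hQ, hR⟩
    refine (numBetween_total (toLex.injective.ne hPQ) (toLex.injective.ne hPR)
      (toLex.injective.ne hQR)).imp ?_ (Or.imp ?_ ?_) <;>
      refine fun h => between_iff_toLex.2 ⟨?_, h⟩
    exacts [⟨g, hP, hQ, hR⟩, ⟨g, hQ, hR, hP⟩, ⟨g, hR, hP, hQ⟩]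
  between_unique P Q R h h' :=
    (between_iff_toLex.1 h).2.not_rotate (between_iff_toLex.1 h').2
  pasch P Q R g _ hP hQ hR := by
    obtain ⟨u, rfl⟩ := g.exists_eqn
    rw [exists_lies_between_iff hP, exists_lies_between_iff hP, exists_lies_between_iff hQ]
    exact fun h => h.left_or_right hR

end Order

section Pappus

variable {K : Type*} [DivisionRing K] {b c d b' c' s t : K}

/-- The line `x + b y = c`. The lines of the configuration that refutes Pappus' theorem are of this
form, and `b` determines the parallel class. -/
def monicLine (b c : K) : Line K := Line.mk 1 b (-c) (Or.inl one_ne_zero)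

theorem lies_monicLine {P : K × K} : Lies P (monicLine b c) ↔ P.1 + b * P.2 = c := by
  rw [monicLine, lies_mk, one_mul, add_neg_eq_zero]

theorem lies_monicLine_left : Lies (c, 0) (monicLine b c) :=
  lies_monicLine.2 (by rw [mul_zero, add_zero])

theorem lies_monicLine_right (h : b * d = c) : Lies (0, d) (monicLine b c) :=
  lies_monicLine.2 ((zero_add _).trans h)

theorem improper_monicLine_eq_iff :
    (monicLine b c).improper = (monicLine b' c').improper ↔ b = b' := by
  rw [monicLine, monicLine, improper_mk_eq_iff]
  simp

theorem parallel_monicLine (h : c ≠ c') : Parallel (monicLine b c) (monicLine b c') := by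
  refine ⟨fun hcc' => h ?_, improper_monicLine_eq_iff.2 rfl⟩
  have hc : Lies (c, 0) (monicLine b c') := hcc' ▸ lies_monicLine_left
  rw [← lies_monicLine.1 hc, mul_zero, add_zero]

theorem eq_monicLine {m : Line K} (hd : d ≠ 0) (hdm : Lies (0, d) m) (hcm : Lies (c, 0) m) :
    m = monicLine (c * d⁻¹) c :=
  line_unique (fun h => hd (congrArg Prod.snd h)) hdm hcm
    (lies_monicLine_right (inv_mul_cancel_right₀ hd c)) lies_monicLine_left

theorem improper_ne_of_not_commute (h : ¬ Commute t s) {m : Line K} (hsm : Lies (0, s) m)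
    (hstm : Lies (s * t, 0) m) : m.improper ≠ (monicLine t c).improper := by
  have hs : s ≠ 0 := fun hs => h (hs ▸ Commute.zero_right t)
  rw [eq_monicLine hs hsm hstm, Ne, improper_monicLine_eq_iff, mul_inv_eq_iff_eq_mul₀ hs]
  exact fun hts => h hts.symm

theorem ne_and_not_parallel_of_not_commute (h : ¬ Commute t s) (m : Line K) (hsm : Lies (0, s) m)
    (hstm : Lies (s * t, 0) m) : m ≠ monicLine t c ∧ ¬ Parallel m (monicLine t c) :=
  ⟨fun hm => improper_ne_of_not_commute h hsm hstm (congrArg Line.improper hm),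
    fun hm => improper_ne_of_not_commute h hsm hstm hm.2⟩

theorem mul_ne_left_of_not_commute (h : ¬ Commute s t) : s * t ≠ s := by
  have hs₀ : s ≠ 0 := fun hs => h (hs ▸ Commute.zero_left t)
  exact (mul_eq_left₀ hs₀).not.2 fun ht => h (ht ▸ Commute.one_right s)

theorem pappusHexagon_of_not_commute (h : ¬ Commute t s) :
    PappusHexagon Lies (xAxis K) (yAxis K) (s * t, 0) (0, t) (t, 0) (0, 1) (s, 0) (0, s) := by
  have hs₀ : s ≠ 0 := fun hs => h (hs ▸ Commute.zero_right t)
  have ht₀ : t ≠ 0 := fun ht => h (ht ▸ Commute.zero_left s)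
  have hs₁ : s ≠ 1 := fun hs => h (hs ▸ Commute.one_right t)
  have ht₁ : t ≠ 1 := fun ht => h (ht ▸ Commute.one_left s)
  have hts : t ≠ s := fun hts => h (hts ▸ Commute.refl t)
  constructor <;> simp only [lies_xAxis_iff, lies_yAxis_iff, ne_eq, Prod.mk.injEq, true_and,
    and_true, mul_eq_zero, mul_eq_left₀ hs₀, mul_eq_right₀ ht₀]
  · intro hxy
    have h₁ : Lies (1, 0) (xAxis K) := lies_xAxis_iff.2 rfl
    rw [hxy, lies_yAxis_iff] at h₁
    exact one_ne_zero h₁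
  · exact ⟨not_or.2 ⟨hs₀, ht₀⟩, ht₀, hs₀⟩
  · exact ⟨ht₀, one_ne_zero, hs₀⟩
  · exact ⟨hs₁, ht₁, hts⟩
  · exact ⟨ht₁, hts, hs₁.symm⟩

theorem pappusHexagon_proper {g h : Line K} {p₁ p₂ p₃ p₄ p₅ p₆ : K × K}
    (H : PappusHexagon Lies g h p₁ p₂ p₃ p₄ p₅ p₆) :
    PappusHexagon ExtLies (.proper g) (.proper h) (.proper p₁) (.proper p₂) (.proper p₃)
      (.proper p₄) (.proper p₅) (.proper p₆) where
  lines_ne e := H.lines_ne (ExtLine.proper.inj e)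
  on_g := H.on_g
  on_h := H.on_h
  not_on_h := H.not_on_h
  not_on_g := H.not_on_g
  ne_on_g := H.ne_on_g.imp (mt ExtPoint.proper.inj)
    (And.imp (mt ExtPoint.proper.inj) (mt ExtPoint.proper.inj))
  ne_on_h := H.ne_on_h.imp (mt ExtPoint.proper.inj)
    (And.imp (mt ExtPoint.proper.inj) (mt ExtPoint.proper.inj))

/-- Two pairs of opposite sides meet at infinity, the third pair meets in a proper point. -/
theorem not_pappus_of_not_commute (h : ¬ Commute t s) : ¬ Pappus (ExtLies (K := K)) := by
  intro hPappus
  have hs₁ : s ≠ 1 := fun hs => h (hs ▸ Commute.one_right t)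
  have hs₀ : s ≠ 0 := fun hs => h (hs ▸ Commute.zero_right t)
  obtain ⟨m, hsm, hstm⟩ := incidenceAxioms_lies.exists_line (0, s) (s * t, 0)
    fun e => hs₀ (congrArg Prod.snd e)
  obtain ⟨R, hRm, hRk⟩ :=
    exists_lies_of_improper_ne (improper_ne_of_not_commute (c := t) h hsm hstm)
  obtain ⟨g | _, hPg, hQg, hRg⟩ := hPappus _ _ _ _ _ _ _ _
    (pappusHexagon_proper (pappusHexagon_of_not_commute h))
    (.proper (monicLine s (s * t))) (.proper (monicLine 1 t)) (.proper (monicLine t t))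
    (.proper (monicLine s s)) (.proper (monicLine 1 s)) (.proper m)
    ⟨lies_monicLine_left, lies_monicLine_right rfl⟩
    ⟨lies_monicLine_right (one_mul t), lies_monicLine_left⟩
    ⟨lies_monicLine_left, lies_monicLine_right (mul_one t)⟩
    ⟨lies_monicLine_right (mul_one s), lies_monicLine_left⟩
    ⟨lies_monicLine_left, lies_monicLine_right (one_mul s)⟩ ⟨hsm, hstm⟩
    (.improper (monicLine s 0).improper) (.improper (monicLine 1 0).improper) (.proper R)
    ⟨improper_monicLine_eq_iff.2 rfl, improper_monicLine_eq_iff.2 rfl⟩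
    ⟨improper_monicLine_eq_iff.2 rfl, improper_monicLine_eq_iff.2 rfl⟩ ⟨hRk, hRm⟩
  · exact hs₁ (improper_monicLine_eq_iff.1 (Eq.trans (Eq.symm hPg) hQg))
  · exact hRg

end Pappus

end CoordPlane

theorem mainTheorem7 :
    ∃ (_ : DivisionRing HilbertNumber) (_ : LinearOrder HilbertNumber),
      -- the operations and the order are the ones defined on double Laurent series
      (∀ a b : HilbertNumber, a + b = a.add b) ∧
      (∀ a b : HilbertNumber, a * b = a.mul b) ∧
      (0 : HilbertNumber) = HilbertNumber.ofReal 0 ∧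
      (1 : HilbertNumber) = HilbertNumber.ofReal 1 ∧
      (∀ a b : HilbertNumber, a < b ↔ (b.sub a).Pos) ∧
      -- the skew field is linearly ordered, proper and non-Archimedean
      IsStrictOrderedRing HilbertNumber ∧
      HilbertNumber.t * HilbertNumber.s = 2 * (HilbertNumber.s * HilbertNumber.t) ∧
      HilbertNumber.t * HilbertNumber.s ≠ HilbertNumber.s * HilbertNumber.t ∧
      ¬ Archimedean HilbertNumber ∧
      0 < HilbertNumber.t ∧
      (∀ m : ℕ, m * HilbertNumber.t < HilbertNumber.s) ∧
      (∀ n : ℕ, n * HilbertNumber.s < 1) ∧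
      -- the coordinate plane
      PlaneGeometry.IncidenceAxioms (CoordPlane.Lies (K := HilbertNumber)) ∧
      (∀ g h : CoordPlane.Line HilbertNumber, g ≠ h →
        (CoordPlane.Parallel g h ↔ ¬ ∃ P, CoordPlane.Lies P g ∧ CoordPlane.Lies P h)) ∧
      PlaneGeometry.OrderAxioms (CoordPlane.Lies (K := HilbertNumber)) CoordPlane.Between ∧
      PlaneGeometry.ParallelPostulate (CoordPlane.Lies (K := HilbertNumber)) ∧
      -- the plane with improper points
      PlaneGeometry.ProjectiveIncidence (CoordPlane.ExtLies (K := HilbertNumber)) ∧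
      PlaneGeometry.Desargues (CoordPlane.ExtLies (K := HilbertNumber)) ∧
      ¬ PlaneGeometry.Pappus (CoordPlane.ExtLies (K := HilbertNumber)) ∧
      -- the explicit configuration: a hexagon with vertices alternately on the coordinate axes
      (∃ (xAxis yAxis g g' k k' l l' : CoordPlane.Line HilbertNumber)
          (p₁ p₂ p₃ p₄ p₅ p₆ : HilbertNumber × HilbertNumber),
        xAxis = CoordPlane.Line.mk 0 1 0 (Or.inr one_ne_zero) ∧
        yAxis = CoordPlane.Line.mk 1 0 0 (Or.inl one_ne_zero) ∧
        g = CoordPlane.Line.mk 1 HilbertNumber.s (-HilbertNumber.s) (Or.inl one_ne_zero) ∧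
        g' = CoordPlane.Line.mk 1 HilbertNumber.s (-(HilbertNumber.s * HilbertNumber.t))
          (Or.inl one_ne_zero) ∧
        k = CoordPlane.Line.mk 1 HilbertNumber.t (-HilbertNumber.t) (Or.inl one_ne_zero) ∧
        k' = CoordPlane.Line.mk 1 HilbertNumber.t (-(HilbertNumber.t * HilbertNumber.s))
          (Or.inl one_ne_zero) ∧
        l = CoordPlane.Line.mk 1 1 (-HilbertNumber.s) (Or.inl one_ne_zero) ∧
        l' = CoordPlane.Line.mk 1 1 (-HilbertNumber.t) (Or.inl one_ne_zero) ∧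
        p₁ = (HilbertNumber.s * HilbertNumber.t, 0) ∧ p₂ = (0, HilbertNumber.t) ∧
        p₃ = (HilbertNumber.t, 0) ∧ p₄ = (0, 1) ∧
        p₅ = (HilbertNumber.s, 0) ∧ p₆ = (0, HilbertNumber.s) ∧
        PlaneGeometry.PappusHexagon CoordPlane.Lies xAxis yAxis p₁ p₂ p₃ p₄ p₅ p₆ ∧
        -- the opposite sides `g' = p₁p₂` and `g = p₄p₅` are parallel
        (CoordPlane.Lies p₁ g' ∧ CoordPlane.Lies p₂ g') ∧
        (CoordPlane.Lies p₄ g ∧ CoordPlane.Lies p₅ g) ∧ CoordPlane.Parallel g' g ∧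
        -- the opposite sides `l' = p₂p₃` and `l = p₅p₆` are parallel
        (CoordPlane.Lies p₂ l' ∧ CoordPlane.Lies p₃ l') ∧
        (CoordPlane.Lies p₅ l ∧ CoordPlane.Lies p₆ l) ∧ CoordPlane.Parallel l' l ∧
        -- `k = p₃p₄` is parallel to `k'`, which goes through `p₆` and the point `(ts, 0)`
        (CoordPlane.Lies p₃ k ∧ CoordPlane.Lies p₄ k) ∧ CoordPlane.Parallel k' k ∧
        CoordPlane.Lies p₆ k' ∧ CoordPlane.Lies (HilbertNumber.t * HilbertNumber.s, 0) k' ∧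
        -- but the connection of `p₆` and `p₁` is not parallel to `k`
        ∀ m, CoordPlane.Lies p₆ m → CoordPlane.Lies p₁ m → m ≠ k ∧ ¬ CoordPlane.Parallel m k) := by
  open scoped HilbertNumber in
  open HilbertNumber CoordPlane in
  have hexagon := pappusHexagon_of_not_commute t_mul_s_ne_s_mul_t
  have ht_s : t ≠ s := fun h => t_mul_s_ne_s_mul_t (h ▸ rfl)
  exact ⟨inferInstance, inferInstance, add_eq_add, mul_eq_mul, zero_eq_ofReal, one_eq_ofReal,
    fun _ _ => lt_iff_pos_sub, inferInstance, t_mul_s, t_mul_s_ne_s_mul_t, not_archimedean, t_pos,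
    natCast_mul_t_lt_s, natCast_mul_s_lt_one,
    incidenceAxioms_lies, fun _ _ => parallel_iff_not_exists_lies, orderAxioms_lies_between,
    parallelPostulate_lies, projectiveIncidence_extLies, (extCoordinates HilbertNumber).desargues,
    not_pappus_of_not_commute t_mul_s_ne_s_mul_t,
    xAxis _, yAxis _, monicLine s s, monicLine s (s * t), monicLine t t, monicLine t (t * s),
    monicLine 1 s, monicLine 1 t, (s * t, 0), (0, t), (t, 0), (0, 1), (s, 0), (0, s),
    rfl, rfl, rfl, rfl, rfl, rfl, rfl, rfl, rfl, rfl, rfl, rfl, rfl, rfl, hexagon,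
    ⟨lies_monicLine_left, lies_monicLine_right rfl⟩,
    ⟨lies_monicLine_right (mul_one s), lies_monicLine_left⟩,
    parallel_monicLine (mul_ne_left_of_not_commute t_mul_s_ne_s_mul_t.symm),
    ⟨lies_monicLine_right (one_mul t), lies_monicLine_left⟩,
    ⟨lies_monicLine_left, lies_monicLine_right (one_mul s)⟩, parallel_monicLine ht_s,
    ⟨lies_monicLine_left, lies_monicLine_right (mul_one t)⟩,
    parallel_monicLine (mul_ne_left_of_not_commute t_mul_s_ne_s_mul_t),
    lies_monicLine_right rfl, lies_monicLine_left,
    ne_and_not_parallel_of_not_commute t_mul_s_ne_s_mul_t⟩
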